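/- Write $\langle u,v\rangle_{\mathbb C^2}=\sum_j u_j\overline{v_j}$, $L^2=L^2(\mathbb R,\mathbb C^2)$, and $H^k=H^k(\mathbb R,\mathbb C^2)$ with $\|u\|_{H^k}^2=\sum_{j=0}^k\|\partial_x^ju\|_{L^2}^2$. Let $\sigma_0$ be the $2\times2$ identity matrix, $\sigma_1,\sigma_2,\sigma_3$ the Pauli matrices, and $\mathbf s\cdot\boldsymbol\sigma=\sum_{\alpha=0}^3 s_\alpha\sigma_\alpha$. Fix a smooth $\mathbf s=(s_0,s_1,s_2,s_3):\mathbb R\to\mathbb R^4$, a Hermitian $2\times 2$ matrix $\gamma$ and $g\in C^\infty(\mathbb R,\mathbb R)$. *Nonlinear quantum walk.* For $\delta>0$ and $u\in \mathcal H_\delta=\ell^2(\delta\mathbb Z,\mathbb C^2)$ put $(\mathcal S_\delta u)(x)=(u_1(x-\delta),u_2(x+\delta))$, $(\mathcal C_\delta u)(x)=e^{-i\delta\,\mathbf s(x)\cdot\boldsymbol\sigma}u(x)$, $(\mathcal N_\delta u)(x)=e^{-i\delta g(\langle u(x),\gamma u(x)\rangle_{\mathbb C^2})\gamma}u(x)$,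 and let $\mathcal U_\delta(0)u=u$, $\mathcal U_\delta(m+1)u=\mathcal S_\delta\mathcal C_\delta\mathcal N_\delta(\mathcal U_\delta(m)u)$. *Nonlinear Dirac equation (NLD).* A solution on $[0,T]$ with initial datum $u_0\in H^s$ is a function $u\in C([0,T],H^s)$ with $u(0)=u_0$ and $$ i\partial_tu=-i\sigma_3\partial_xu+\mathbf s\cdot\boldsymbol\sigma\,u+g(\langle u,\gamma u\rangle_{\mathbb C^2})\gamma u ;$$ it is denoted by $U_{\mathrm{Dirac}}(t)u_0$. The pair $(T,L)$ satisfies condition $(\mathrm{Lip})_s$ if there is $C>0$ such that for all $u_1,u_2\in H^s$ with $\|u_j\|_{H^s}\le L$ the solutions $U_{\mathrm{Dirac}}(\cdot)u_j\in C([0,T],H^s)$ exist and $\sup_{0\le t\le T}\|U_{\mathrm{Dirac}}(t)u_1-U_{\mathrm{Dirac}}(t)u_2\|_{H^s}\le C\|u_1-u_2\|_{H^s}$. *Shannon interpolation.* Let $F$ be the unitary Fourier transform $Fu(\xi)=\frac1{\sqrt{2\pi}}\int e^{-ix\xi}u(x)\,dx$ on $L^2$, let $j_\delta=F^{-1}\chi_{[-\pi/\delta,\pi/\delta]}F$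 be the projection of $L^2$ onto the space $H_\delta$ of the functions whose Fourier transform is supported in $[-\pi/\delta,\pi/\delta]$, and let $I_\delta:\mathcal H_\delta\to H_\delta$ be the bijection for which $F(I_\delta u)(\xi)=\frac{\delta}{\sqrt{2\pi}}\sum_{x\in\delta\mathbb Z}e^{-ix\xi}u(x)$ for $|\xi|\le\pi/\delta$ and $F(I_\delta u)(\xi)=0$ otherwise. **Statement.** Let $s\ge1$ be an integer and $T,L>0$. Assume $\|\mathbf s\|_{L^\infty}+\|\mathbf s'\|_{H^s(\mathbb R,\mathbb R^4)}<\infty$, that $(T,L)$ satisfies $(\mathrm{Lip})_s$, and that $u_0\in H^{s+1}$ with $\|u_0\|_{H^{s+1}}\le L$. Then $$\lim_{\delta\to0^+}\ \sup_{m\in\mathbb Z,\ 0\le m\delta\le T}\bigl\| I_\delta\circ\mathcal U_\delta(m)\circ I_\delta^{-1}\circ j_\delta u_0-U_{\mathrm{Dirac}}(m\delta)u_0\bigr\|_{L^2}=0 .$$ In particular (the case $g=0$) this covers the convergence of the linear quantum walk to the linear Dirac equation. -/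

import Mathlib

open MeasureTheory Filter Topology
open scoped ContDiff FourierTransform SchwartzMap LineDeriv

noncomputable section

namespace NLQW

/-- `ℂ²` with its Hermitian norm. -/
abbrev Spinor : Type := EuclideanSpace ℂ (Fin 2)

/-- `L² = L²(ℝ, ℂ²)`. -/
abbrev L2 : Type := Lp Spinor 2 (volume : Measure ℝ)

/-- Real `4`-vectors `(s₀, s₁, s₂, s₃)`. -/
abbrev Coeff : Type := EuclideanSpace ℝ (Fin 4)

abbrev Mat2 : Type := Matrix (Fin 2) (Fin 2) ℂ

/-! ### Matrices -/

/-- The Pauli matrices `σ₀, σ₁, σ₂, σ₃`. -/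
def pauli : Fin 4 → Mat2 :=
  ![!![1, 0; 0, 1], !![0, 1; 1, 0], !![0, -Complex.I; Complex.I, 0], !![1, 0; 0, -1]]

/-- `c · σ = ∑ α, c α σ_α`. -/
def pauliDot (c : Coeff) : Mat2 := ∑ α, (c α : ℂ) • pauli α

/-- A matrix applied to a vector of `ℂ²`. -/
def act (A : Mat2) (v : Spinor) : Spinor := WithLp.toLp 2 (A.mulVec v.ofLp)

/-- The real number `⟨v, γ v⟩_{ℂ²} = ∑ j, v_j * conj ((γ v)_j)` (for Hermitian `γ`; Mathlib's inner
product is conjugate linear in its first argument). -/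
def quadForm (γ : Mat2) (v : Spinor) : ℝ := (inner ℂ (act γ v) v).re

/-! ### The nonlinear quantum walk

A function on `δℤ` is written as a function of `n : ℤ`, its value at the point `x = δ n`. -/

/-- The shift `S_δ`: `(S_δ u)(x) = (u₁(x - δ), u₂(x + δ))`. -/
def shift (u : ℤ → Spinor) : ℤ → Spinor := fun n => !₂[u (n - 1) 0, u (n + 1) 1]

/-- The linear coin `(C_δ u)(x) = exp(-i δ a(x)·σ) u(x)`. -/
def coin (a : ℝ → Coeff) (δ : ℝ) (u : ℤ → Spinor) : ℤ → Spinor := fun n =>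
  act (NormedSpace.exp (-(Complex.I * (δ : ℂ)) • pauliDot (a (δ * n)))) (u n)

/-- The nonlinear coin `(N_δ u)(x) = exp(-i δ g(⟨u(x), γ u(x)⟩) γ) u(x)`. -/
def nonlinearCoin (γ : Mat2) (g : ℝ → ℝ) (δ : ℝ) (u : ℤ → Spinor) : ℤ → Spinor := fun n =>
  act (NormedSpace.exp (-(Complex.I * (δ : ℂ) * (g (quadForm γ (u n)) : ℂ)) • γ)) (u n)

/-- The walk: `U_δ(0) u = u`, `U_δ(m+1) u = S_δ C_δ N_δ (U_δ(m) u)`. -/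
def walk (a : ℝ → Coeff) (γ : Mat2) (g : ℝ → ℝ) (δ : ℝ) : ℕ → (ℤ → Spinor) → (ℤ → Spinor)
  | 0, u => u
  | m + 1, u => shift (coin a δ (nonlinearCoin γ g δ (walk a γ g δ m u)))

/-! ### Band limitation and Shannon interpolation

Mathlib's Fourier transform is `𝓕 f (η) = ∫ exp(-2πi x η) f x dx`. In terms of the angular frequency
`ξ = 2πη` the band `|ξ| ≤ π/δ` is `|η| ≤ 1/(2δ)`. -/

/-- The band `|2πη| ≤ π/δ`. -/
def band (δ : ℝ) : Set ℝ := Set.Icc (-(1 / (2 * δ))) (1 / (2 * δ))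

/-- `j_δ = F⁻¹ χ_{[-π/δ, π/δ]} F`, the projection of `L²` onto the space `H_δ` of band-limited
functions. -/
def bandProj (δ : ℝ) (f : L2) : L2 :=
  𝓕⁻ (((Lp.memLp (𝓕 f : L2)).indicator (s := band δ) measurableSet_Icc).toLp _ : L2)

theorem memLp_latticeMode (δ : ℝ) (n : ℤ) (c : Spinor) :
    MemLp ((band δ).indicator fun η : ℝ =>
      ((δ : ℂ) * Complex.exp (-(2 * Real.pi * Complex.I * (δ * n * η)))) • c) 2 volume := by
  rw [memLp_indicator_iff_restrict (s := band δ) measurableSet_Icc]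
  have : IsFiniteMeasure (volume.restrict (band δ)) := by
    unfold band; infer_instance
  refine MemLp.of_bound (C := |δ| * ‖c‖) ?_ ?_
  · exact Continuous.aestronglyMeasurable (by fun_prop)
  · refine Eventually.of_forall fun η => ?_
    have h : -(2 * Real.pi * Complex.I * (δ * n * η) : ℂ)
        = ((-(2 * Real.pi * (δ * n * η)) : ℝ) : ℂ) * Complex.I := by
      push_cast; ring
    rw [norm_smul, norm_mul, h, Complex.norm_exp_ofReal_mul_I]
    simp

/-- The function `η ↦ δ exp(-i x ξ) c` (`x = δ n`, `ξ = 2πη`) on the band, extended by zero. -/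
def latticeMode (δ : ℝ) (n : ℤ) (c : Spinor) : L2 := (memLp_latticeMode δ n c).toLp _

/-- The discrete Fourier transform `ξ ↦ δ ∑ₓ exp(-i x ξ) u(x)` of `u ∈ ℓ²(δℤ, ℂ²)` on the band,
extended by zero. The sum is an (orthogonal) series in `L²`. -/
def discreteFourier (δ : ℝ) (u : ℤ → Spinor) : L2 := ∑' n : ℤ, latticeMode δ n (u n)

/-- The Shannon interpolation `I_δ : ℓ²(δℤ, ℂ²) → H_δ ⊆ L²`. -/
def shannon (δ : ℝ) (u : ℤ → Spinor) : L2 := 𝓕⁻ (discreteFourier δ u)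

/-- The inverse `I_δ⁻¹ : H_δ → ℓ²(δℤ, ℂ²)`: the Fourier transform followed by the inverse
discrete Fourier transform. -/
def shannonInv (δ : ℝ) (f : L2) : ℤ → Spinor := fun n =>
  ∫ η in band δ, Complex.exp (2 * Real.pi * Complex.I * (δ * n * η)) • (𝓕 f : L2) η

/-! ### Sobolev spaces `H^k(ℝ, ℂ²)` -/

/-- `v ∈ L²` is the `j`-th weak (distributional) derivative of `u ∈ L²`. -/
def IsWeakDeriv (j : ℕ) (u v : L2) : Prop :=
  (fun S : 𝓢'(ℝ, Spinor) => ∂_{(1 : ℝ)} S)^[j] (u : 𝓢'(ℝ, Spinor)) = (v : 𝓢'(ℝ, Spinor))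

open Classical in
/-- The `j`-th weak derivative of `u` if it exists in `L²`, and `0` otherwise. -/
def weakDeriv (j : ℕ) (u : L2) : L2 :=
  if h : ∃ v, IsWeakDeriv j u v then h.choose else 0

/-- `u ∈ H^k`. -/
def MemH (k : ℕ) (u : L2) : Prop := ∀ j ≤ k, ∃ v, IsWeakDeriv j u v

/-- `‖u‖_{H^k} = (∑_{j ≤ k} ‖∂ₓʲ u‖²)^{1/2}`. -/
def sobolevNorm (k : ℕ) (u : L2) : ℝ :=
  √(∑ j ∈ Finset.range (k + 1), ‖weakDeriv j u‖ ^ 2)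

/-! ### The nonlinear Dirac equation -/

/-- `u ∈ C([0, T], H^s)` with `u(0) = u₀` solves
`i ∂ₜ u = -i σ₃ ∂ₓ u + a·σ u + g(⟨u, γ u⟩) γ u` on `[0, T]`, the time derivative being the
derivative of an `L²`-valued function (one-sided at the end points). -/
structure IsDiracSolution (s : ℕ) (a : ℝ → Coeff) (γ : Mat2) (g : ℝ → ℝ) (T : ℝ) (u₀ : L2)
    (u : ℝ → L2) : Prop where
  initial : u 0 = u₀
  memH : ∀ t ∈ Set.Icc 0 T, MemH s (u t)
  continuous : ∀ t₀ ∈ Set.Icc 0 T,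
    Tendsto (fun t => sobolevNorm s (u t - u t₀)) (𝓝[Set.Icc 0 T] t₀) (𝓝 0)
  equation : ∀ t ∈ Set.Icc 0 T, ∃ w : L2, HasDerivWithinAt u w (Set.Icc 0 T) t ∧
    ∀ᵐ x : ℝ, Complex.I • w x =
      -Complex.I • act (pauli 3) (weakDeriv 1 (u t) x) + act (pauliDot (a x)) (u t x)
        + (g (quadForm γ (u t x)) : ℂ) • act γ (u t x)

/-- Condition `(Lip)_s` for the pair `(T, L)`: the initial data in the ball of radius `L` of `H^s`
have solutions in `C([0, T], H^s)`, and these depend on the data in a Lipschitz way. -/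
def LipCondition (s : ℕ) (a : ℝ → Coeff) (γ : Mat2) (g : ℝ → ℝ) (T L : ℝ) : Prop :=
  ∃ C : ℝ, 0 < C ∧ ∀ u₁ u₂ : L2, MemH s u₁ → MemH s u₂ →
    sobolevNorm s u₁ ≤ L → sobolevNorm s u₂ ≤ L →
      ∃ v₁ v₂ : ℝ → L2, IsDiracSolution s a γ g T u₁ v₁ ∧ IsDiracSolution s a γ g T u₂ v₂ ∧
        ∀ t ∈ Set.Icc 0 T, sobolevNorm s (v₁ t - v₂ t) ≤ C * sobolevNorm s (u₁ - u₂)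

end NLQW

end

open NLQW

/-! Besides Shannon interpolation, a lattice function has a second embedding into `L²`: the step
function `step δ w`, constant on the cells `[δn, δn + δ)`. Both embeddings scale the ℓ² norm by
`√δ`, so differences have equal norms in either picture (`norm_shannon_sub`). On step functions the
walk is transparent: the shift is exactly the free Dirac flow `transport δ` (`transport_step`), and
the coins act pointwise. The walk is thus a splitting scheme for the Dirac equation, and convergence
follows from consistency and stability.

Consistency: pulled back along the free flow, a solution has time derivative `-i` times the
pulled-back potential term, so `transport (-δ) (u (t + δ))` is an Euler step up to `o(δ)`, uniformly
in `t` (`eventually_norm_transport_sub_le`). The coins perform the same Euler step up to `o(δ)`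
(`eventually_stepCoin_euler`). Stability: the free flow is isometric and the coins are Lipschitz
with constant `1 + O(δ)` (`exists_stepCoin_bounds`). A discrete Gronwall inequality sums the errors
(`eventually_norm_sub_le`). Only `o(δ)` per step is needed, so one spatial derivative in `L²` is
enough.

The Lipschitz bound requires a tame nonlinearity, so `g` is cut off outside a ball larger than the
range of the solution, which is bounded by Sobolev embedding and compactness in time. To remove the
cutoff, the truncated walk is shown to have difference quotients bounded in `L²` uniformly in `δ`
(`exists_norm_trans_sub_le`). Together with closeness in `L²` to a bounded function this gives a sup
bound (`norm_apply_le_of_norm_step_sub_lt`), so the cutoff never acts (`walk_eq_truncWalk`).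
Finally, sampling and band projection tend to the identity uniformly on the compact orbit `{u(t)}`,
which carries the estimate from step functions to Shannon interpolation. -/

noncomputable section

/-! ### Pointwise analysis of the coins. -/

namespace NLQW

/-! ### Matrix exponentials acting on spinors -/

/-- A matrix as a bounded operator on `ℂ²`. -/
abbrev op (A : Mat2) : Spinor →L[ℂ] Spinor := Matrix.toEuclideanCLM (𝕜 := ℂ) A

theorem act_eq_op (A : Mat2) (v : Spinor) : act A v = op A v := rfl

theorem continuous_toEuclideanCLM : Continuous (Matrix.toEuclideanCLM (n := Fin 2) (𝕜 := ℂ)) :=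
  (Matrix.toEuclideanCLM (n := Fin 2) (𝕜 := ℂ)).toAlgEquiv.toLinearMap.continuous_of_finiteDimensional

theorem op_exp (A : Mat2) : op (NormedSpace.exp A) = NormedSpace.exp (op A) := by
  let _ : NormedRing Mat2 := Matrix.linftyOpNormedRing
  let _ : NormedAlgebra ℂ Mat2 := Matrix.linftyOpNormedAlgebra
  let _ : NormedAlgebra ℚ Mat2 := NormedAlgebra.restrictScalars ℚ ℂ Mat2
  exact NormedSpace.map_exp (Matrix.toEuclideanCLM (n := Fin 2) (𝕜 := ℂ)) continuous_toEuclideanCLM A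

theorem star_exp_mul_exp_of_star_eq_neg {X : Spinor →L[ℂ] Spinor} (hX : star X = -X) :
    star (NormedSpace.exp X) * NormedSpace.exp X = 1 := by
  have h : star (NormedSpace.exp X) = NormedSpace.exp (star X) := NormedSpace.star_exp X
  let _ : NormedAlgebra ℚ (Spinor →L[ℂ] Spinor) := NormedAlgebra.restrictScalars ℚ ℂ _
  rw [h, hX, ← NormedSpace.exp_add_of_commute (Commute.refl X).neg_left, neg_add_cancel,
    NormedSpace.exp_zero]

theorem norm_exp_apply_of_star_eq_neg {X : Spinor →L[ℂ] Spinor} (hX : star X = -X) (v : Spinor) :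
    ‖NormedSpace.exp X v‖ = ‖v‖ := by
  have h := star_exp_mul_exp_of_star_eq_neg hX
  generalize NormedSpace.exp X = U at h
  rw [ContinuousLinearMap.star_eq_adjoint] at h
  exact (ContinuousLinearMap.norm_map_iff_adjoint_comp_self U).2 h v

theorem star_op (A : Mat2) : star (op A) = op (star A) :=
  (map_star (Matrix.toEuclideanCLM (n := Fin 2) (𝕜 := ℂ)) A).symm

theorem op_smul (z : ℂ) (A : Mat2) : op (z • A) = z • op A :=
  map_smul (Matrix.toEuclideanCLM (n := Fin 2) (𝕜 := ℂ)) z A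

theorem op_sub (A B : Mat2) : op (A - B) = op A - op B :=
  map_sub (Matrix.toEuclideanCLM (n := Fin 2) (𝕜 := ℂ)) A B

theorem norm_act_exp {A : Mat2} (hA : A.IsHermitian) (t : ℝ) (v : Spinor) :
    ‖act (NormedSpace.exp (-(Complex.I * (t : ℂ)) • A)) v‖ = ‖v‖ := by
  rw [act_eq_op, op_exp]
  refine norm_exp_apply_of_star_eq_neg ?_ v
  rw [star_op, star_smul, Matrix.star_eq_conjTranspose, hA.eq, op_smul, op_smul]
  ext1 w
  rw [neg_apply, smul_apply, smul_apply]
  simp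

/-- This is strict differentiability of the exponential at `0`. With `ε = 1` it makes `exp`
2-Lipschitz near `0`; with small `ε` it gives the Euler step with error `o(δ)`. -/
theorem exp_sub_exp_sub_le {ε : ℝ} (hε : 0 < ε) :
    ∃ r > 0, ∀ X Y : Spinor →L[ℂ] Spinor, ‖X‖ ≤ r → ‖Y‖ ≤ r →
      ‖NormedSpace.exp X - NormedSpace.exp Y - (X - Y)‖ ≤ ε * ‖X - Y‖ := by
  have h := (hasStrictFDerivAt_exp_zero (𝕂 := ℂ) (𝔸 := Spinor →L[ℂ] Spinor)).isLittleO.def hε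
  rw [nhds_prod_eq, Metric.nhds_basis_closedBall.prod_self.eventually_iff] at h
  obtain ⟨r, hr, h⟩ := h
  refine ⟨r, hr, fun X Y hX hY => ?_⟩
  simpa using @h (X, Y) (by simp [hX, hY])

theorem pauli_isHermitian (α : Fin 4) : (pauli α).IsHermitian := by
  fin_cases α <;> (ext i j; fin_cases i <;> fin_cases j <;> simp [pauli])

theorem pauliDot_isHermitian (c : Coeff) : (pauliDot c).IsHermitian := by
  unfold pauliDot Matrix.IsHermitian
  rw [Matrix.conjTranspose_sum]
  refine Finset.sum_congr rfl fun α _ => ?_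
  rw [Matrix.conjTranspose_smul, (pauli_isHermitian α).eq]
  simp

theorem pauliDot_sub (c d : Coeff) : pauliDot (c - d) = pauliDot c - pauliDot d := by
  simp [pauliDot, sub_smul, Finset.sum_sub_distrib]

theorem norm_op_pauliDot_le : ∃ K, 0 ≤ K ∧ ∀ c : Coeff, ‖op (pauliDot c)‖ ≤ K * ‖c‖ := by
  refine ⟨∑ α, ‖op (pauli α)‖, by positivity, fun c => ?_⟩
  rw [pauliDot, op, map_sum, Finset.sum_mul]
  refine (norm_sum_le _ _).trans (Finset.sum_le_sum fun α _ => ?_)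
  rw [map_smul, norm_smul, mul_comm]
  gcongr
  simpa using PiLp.norm_apply_le c α

/-! ### The local evolution of the walk -/

/-- The two coins acting on the spinor `v` at the point `y`, with the nonlinearity `v ↦ G v`. -/
def coinMap (a : ℝ → Coeff) (γ : Mat2) (G : Spinor → ℝ) (δ y : ℝ) (v : Spinor) : Spinor :=
  act (NormedSpace.exp (-(Complex.I * (δ : ℂ)) • pauliDot (a y)))
    (act (NormedSpace.exp (-(Complex.I * (δ : ℂ) * (G v : ℂ)) • γ)) v)

/-- The zeroth order terms of the Dirac equation, with the nonlinearity `v ↦ G v`. -/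
def potential (a : ℝ → Coeff) (γ : Mat2) (G : Spinor → ℝ) (y : ℝ) (v : Spinor) : Spinor :=
  act (pauliDot (a y)) v + (G v : ℂ) • act γ v

/-- A bounded Lipschitz coefficient `a` and a bounded nonlinearity `G` such that `v ↦ G v • v`
is Lipschitz. -/
structure TameCoefficients (a : ℝ → Coeff) (G : Spinor → ℝ) (K : ℝ) : Prop where
  nonneg : 0 ≤ K
  bound : ∀ x, ‖a x‖ ≤ K
  lipschitz : ∀ x y, ‖a x - a y‖ ≤ K * |x - y|
  nl_bound : ∀ v, |G v| ≤ K
  nl_lipschitz : ∀ v w, |G v - G w| * ‖w‖ ≤ K * ‖v - w‖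

variable {a : ℝ → Coeff} {γ : Mat2} {G : Spinor → ℝ} {K : ℝ}

theorem norm_coinMap (hγ : γ.IsHermitian) (δ y : ℝ) (v : Spinor) :
    ‖coinMap a γ G δ y v‖ = ‖v‖ := by
  rw [coinMap, norm_act_exp (pauliDot_isHermitian _)]
  have := norm_act_exp hγ (δ * G v) v
  push_cast at this
  rw [← mul_assoc] at this
  exact this

theorem norm_op_smul (z : ℝ) (H : Mat2) : ‖op (-(Complex.I * (z : ℂ)) • H)‖ = |z| * ‖op H‖ := by
  rw [op_smul, norm_smul]; simp

theorem coinMap_eq (δ y : ℝ) (v : Spinor) :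
    coinMap a γ G δ y v = NormedSpace.exp (op (-(Complex.I * (δ : ℂ)) • pauliDot (a y)))
      (NormedSpace.exp (op (-(Complex.I * ((δ * G v : ℝ) : ℂ)) • γ)) v) := by
  rw [coinMap, act_eq_op, act_eq_op, op_exp, op_exp]
  push_cast
  rw [← mul_assoc]

theorem norm_exp_op_apply {H : Mat2} (hH : H.IsHermitian) (z : ℝ) (v : Spinor) :
    ‖NormedSpace.exp (op (-(Complex.I * (z : ℂ)) • H)) v‖ = ‖v‖ := by
  rw [← op_exp, ← act_eq_op, norm_act_exp hH]

/-- Uniform smallness of the generators of the coins. -/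
theorem TameCoefficients.exists_generator_bound (h : TameCoefficients a G K) (γ : Mat2) :
    ∃ B, 0 ≤ B ∧ (∀ δ y : ℝ, ‖op (-(Complex.I * (δ : ℂ)) • pauliDot (a y))‖ ≤ |δ| * B) ∧
      (∀ (δ : ℝ) (v : Spinor), ‖op (-(Complex.I * ((δ * G v : ℝ) : ℂ)) • γ)‖ ≤ |δ| * B) ∧
      (∀ δ y y' : ℝ, ‖op (-(Complex.I * (δ : ℂ)) • pauliDot (a y))
        - op (-(Complex.I * (δ : ℂ)) • pauliDot (a y'))‖ ≤ |δ| * (B * |y - y'|)) ∧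
      (∀ (δ : ℝ) (v w : Spinor), ‖op (-(Complex.I * ((δ * G v : ℝ) : ℂ)) • γ)
        - op (-(Complex.I * ((δ * G w : ℝ) : ℂ)) • γ)‖ * ‖w‖ ≤ |δ| * (B * ‖v - w‖)) := by
  obtain ⟨P, hP, hpd⟩ := norm_op_pauliDot_le
  have hK := h.nonneg
  refine ⟨P * K + K * ‖op γ‖, by positivity, fun δ y => ?_, fun δ v => ?_, fun δ y y' => ?_,
    fun δ v w => ?_⟩
  · rw [norm_op_smul]
    gcongr
    calc _ ≤ P * ‖a y‖ := hpd _
      _ ≤ P * K := by gcongr; exact h.bound y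
      _ ≤ _ := le_add_of_nonneg_right (by positivity)
  · rw [norm_op_smul, abs_mul, mul_assoc]
    gcongr
    calc _ ≤ K * ‖op γ‖ := by gcongr; exact h.nl_bound v
      _ ≤ _ := le_add_of_nonneg_left (by positivity)
  · rw [← op_sub, ← smul_sub, ← pauliDot_sub, norm_op_smul]
    gcongr
    calc _ ≤ P * ‖a y - a y'‖ := hpd _
      _ ≤ P * (K * |y - y'|) := by gcongr; exact h.lipschitz y y'
      _ ≤ _ := by
        rw [← mul_assoc]; gcongr; exact le_add_of_nonneg_right (by positivity)
  · have : (-(Complex.I * ((δ * G v : ℝ) : ℂ)) • γ) - (-(Complex.I * ((δ * G w : ℝ) : ℂ)) • γ)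
        = -(Complex.I * ((δ * (G v - G w) : ℝ) : ℂ)) • γ := by
      rw [← sub_smul]; push_cast; ring_nf
    rw [← op_sub, this, norm_op_smul, abs_mul]
    calc |δ| * |G v - G w| * ‖op γ‖ * ‖w‖ = |δ| * (‖op γ‖ * (|G v - G w| * ‖w‖)) := by ring
      _ ≤ |δ| * (‖op γ‖ * (K * ‖v - w‖)) := by gcongr _ * (_ * ?_); exact h.nl_lipschitz v w
      _ ≤ |δ| * ((P * K + K * ‖op γ‖) * ‖v - w‖) := by
        gcongr ?_ * ?_
        nlinarith [mul_nonneg (mul_nonneg hP hK) (norm_nonneg (v - w))]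

theorem eventually_small (B : ℝ) {r : ℝ} (hr : 0 < r) : ∀ᶠ δ : ℝ in 𝓝[>] 0, |δ| * B ≤ r := by
  refine eventually_nhdsWithin_of_eventually_nhds ?_
  have : Tendsto (fun δ : ℝ => |δ| * B) (𝓝 0) (𝓝 (|0| * B)) := by
    exact Continuous.tendsto (by fun_prop) 0
  rw [abs_zero, zero_mul] at this
  exact (this.eventually (gt_mem_nhds hr)).mono fun _ => le_of_lt

theorem norm_exp_sub_le_of {r : ℝ} (hr : ∀ X Y : Spinor →L[ℂ] Spinor, ‖X‖ ≤ r → ‖Y‖ ≤ r →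
      ‖NormedSpace.exp X - NormedSpace.exp Y - (X - Y)‖ ≤ 1 * ‖X - Y‖)
    {X Y : Spinor →L[ℂ] Spinor} (hX : ‖X‖ ≤ r) (hY : ‖Y‖ ≤ r) :
    ‖NormedSpace.exp X - NormedSpace.exp Y‖ ≤ 2 * ‖X - Y‖ := by
  have h1 := hr X Y hX hY
  have h2 := norm_add_le (NormedSpace.exp X - NormedSpace.exp Y - (X - Y)) (X - Y)
  rw [sub_add_cancel] at h2
  linarith

/-- The local evolution is Lipschitz in the spinor with constant `1 + O(δ)`, and Lipschitz in the
position with constant `O(δ)`. -/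
theorem TameCoefficients.exists_coinMap_lipschitz (h : TameCoefficients a G K)
    (hγ : γ.IsHermitian) :
    ∃ B, 0 ≤ B ∧ ∀ᶠ δ : ℝ in 𝓝[>] 0,
      (∀ y v w, ‖coinMap a γ G δ y v - coinMap a γ G δ y w‖ ≤ (1 + B * δ) * ‖v - w‖) ∧
      (∀ y y' v, ‖coinMap a γ G δ y v - coinMap a γ G δ y' v‖ ≤ B * δ * |y - y'| * ‖v‖) := by
  obtain ⟨B, hB, hB1, hB2, hB3, hB4⟩ := h.exists_generator_bound γ
  obtain ⟨r, hr, hexp⟩ := exp_sub_exp_sub_le one_pos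
  refine ⟨2 * B, by positivity, ?_⟩
  filter_upwards [eventually_small B hr, self_mem_nhdsWithin] with δ hδ hδ0
  have hδ0 : 0 < δ := hδ0
  constructor
  · intro y v w
    rw [coinMap_eq, coinMap_eq, ← map_sub, norm_exp_op_apply (pauliDot_isHermitian _)]
    set X := op (-(Complex.I * ((δ * G v : ℝ) : ℂ)) • γ) with hX
    set Y := op (-(Complex.I * ((δ * G w : ℝ) : ℂ)) • γ) with hY
    -- The difference of the two exponentials acts on `w` alone, so the variation of `G` always
    -- appears multiplied by `‖w‖`. This is the source of the weighted form of `nl_lipschitz`.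
    have e : NormedSpace.exp X v - NormedSpace.exp Y w
        = NormedSpace.exp X (v - w) + (NormedSpace.exp X - NormedSpace.exp Y) w := by
      simp
    rw [e]
    refine (norm_add_le _ _).trans ?_
    rw [hX, norm_exp_op_apply hγ, ← hX, add_mul, one_mul]
    gcongr
    calc _ ≤ ‖NormedSpace.exp X - NormedSpace.exp Y‖ * ‖w‖ := ContinuousLinearMap.le_opNorm _ _
      _ ≤ 2 * ‖X - Y‖ * ‖w‖ := by
        gcongr
        exact norm_exp_sub_le_of hexp ((hB2 δ v).trans hδ) ((hB2 δ w).trans hδ)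
      _ = 2 * (‖X - Y‖ * ‖w‖) := by ring
      _ ≤ 2 * (|δ| * (B * ‖v - w‖)) := by gcongr 2 * ?_; exact hB4 δ v w
      _ = _ := by rw [abs_of_pos hδ0]; ring
  · intro y y' v
    rw [coinMap_eq, coinMap_eq, ← sub_apply]
    refine (ContinuousLinearMap.le_opNorm _ _).trans ?_
    rw [norm_exp_op_apply hγ]
    gcongr
    refine (norm_exp_sub_le_of hexp ((hB1 δ y).trans hδ) ((hB1 δ y').trans hδ)).trans ?_
    have := hB3 δ y y'
    rw [abs_of_pos hδ0] at this
    linarith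

theorem TameCoefficients.potential_lipschitz (h : TameCoefficients a G K) (γ : Mat2) :
    ∃ B, 0 ≤ B ∧ (∀ y v, ‖potential a γ G y v‖ ≤ B * ‖v‖) ∧
      (∀ y v w, ‖potential a γ G y v - potential a γ G y w‖ ≤ B * ‖v - w‖) ∧
      (∀ y y' v, ‖potential a γ G y v - potential a γ G y' v‖ ≤ B * |y - y'| * ‖v‖) := by
  obtain ⟨P, hP, hpd⟩ := norm_op_pauliDot_le
  have hK := h.nonneg
  have key : ∀ y v w, ‖potential a γ G y v - potential a γ G y w‖
      ≤ (P * K + 2 * K * ‖op γ‖) * ‖v - w‖ := by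
    intro y v w
    have e : potential a γ G y v - potential a γ G y w = op (pauliDot (a y)) (v - w)
        + (G v : ℂ) • op γ (v - w) + ((G v - G w : ℝ) : ℂ) • op γ w := by
      simp only [potential, act_eq_op, map_sub, smul_sub, Complex.ofReal_sub, sub_smul]
      abel
    rw [e]
    refine (norm_add₃_le).trans ?_
    rw [norm_smul, norm_smul, Complex.norm_real, Complex.norm_real, Real.norm_eq_abs,
      Real.norm_eq_abs]
    have h1 : ‖op (pauliDot (a y)) (v - w)‖ ≤ P * K * ‖v - w‖ := by
      refine (ContinuousLinearMap.le_opNorm _ _).trans ?_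
      gcongr
      exact (hpd _).trans (by gcongr; exact h.bound y)
    have h2 : |G v| * ‖op γ (v - w)‖ ≤ K * (‖op γ‖ * ‖v - w‖) := by
      gcongr
      · exact h.nl_bound v
      · exact ContinuousLinearMap.le_opNorm _ _
    have h3 : |G v - G w| * ‖op γ w‖ ≤ ‖op γ‖ * (K * ‖v - w‖) := by
      calc _ ≤ |G v - G w| * (‖op γ‖ * ‖w‖) := by
            gcongr; exact ContinuousLinearMap.le_opNorm _ _
        _ = ‖op γ‖ * (|G v - G w| * ‖w‖) := by ring
        _ ≤ _ := by gcongr _ * ?_; exact h.nl_lipschitz v w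
    linarith
  refine ⟨P * K + 2 * K * ‖op γ‖, by positivity, fun y v => ?_, key, fun y y' v => ?_⟩
  · have h0 : potential a γ G y 0 = 0 := by simp [potential, act_eq_op]
    simpa [h0] using key y v 0
  · have e : potential a γ G y v - potential a γ G y' v = op (pauliDot (a y - a y')) v := by
      rw [pauliDot_sub, op_sub]
      simp [potential, act_eq_op]
    rw [e]
    refine (ContinuousLinearMap.le_opNorm _ _).trans ?_
    gcongr
    calc _ ≤ P * (K * |y - y'|) := (hpd _).trans (by gcongr; exact h.lipschitz y y')
      _ = P * K * |y - y'| := by ring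
      _ ≤ _ := by gcongr; exact le_add_of_nonneg_right (by positivity)

/-- The local evolution is an Euler step for the potential, up to `o(δ)`. -/
theorem TameCoefficients.eventually_coinMap_euler (h : TameCoefficients a G K)
    (hγ : γ.IsHermitian) {ε : ℝ} (hε : 0 < ε) :
    ∀ᶠ δ : ℝ in 𝓝[>] 0, ∀ y v,
      ‖coinMap a γ G δ y v - (v - (δ * Complex.I : ℂ) • potential a γ G y v)‖ ≤ ε * δ * ‖v‖ := by
  obtain ⟨B, hB, hB1, hB2, -, -⟩ := h.exists_generator_bound γ
  obtain ⟨r₁, hr₁, hexp₁⟩ := exp_sub_exp_sub_le one_pos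
  -- The three remainders below contribute 1, 2 and 1 times this number times `δB`, hence the 4; `B
  -- + 1` avoids division by zero. The same value serves as relative error of the exponentials and,
  -- in `hθ`, as a bound for `δB`.
  have hη : 0 < ε / (4 * (B + 1)) := by positivity
  obtain ⟨r, hr, hexp⟩ := exp_sub_exp_sub_le hη
  have hθ : 0 < ε / (4 * (B + 1)) := by positivity
  filter_upwards [eventually_small B hr₁, eventually_small B hr, eventually_small B hθ,
    self_mem_nhdsWithin] with δ hδ₁ hδ₂ hδ₃ hδ0
  have hδ0 : 0 < δ := hδ0
  intro y v
  rw [coinMap_eq]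
  have bX := hB1 δ y
  have bY := hB2 δ v
  set X := op (-(Complex.I * (δ : ℂ)) • pauliDot (a y)) with hX
  set Y := op (-(Complex.I * ((δ * G v : ℝ) : ℂ)) • γ) with hY
  have e : (v - (δ * Complex.I : ℂ) • potential a γ G y v) = v + X v + Y v := by
    simp only [hX, hY, op_smul]
    simp only [potential, act_eq_op, smul_apply, smul_add, smul_smul, neg_smul]
    push_cast
    rw [show (Complex.I * (δ * G v) : ℂ) = δ * Complex.I * G v by ring, mul_comm Complex.I (δ : ℂ)]
    abel
  -- First-order remainder of each exponential, plus the cross term `X (exp Y - 1)`, which is of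
  -- second order in `δ`.
  have e2 : NormedSpace.exp X (NormedSpace.exp Y v) - (v + X v + Y v)
      = (NormedSpace.exp X - NormedSpace.exp 0 - (X - 0)) (NormedSpace.exp Y v)
        + X ((NormedSpace.exp Y - NormedSpace.exp 0) v)
        + (NormedSpace.exp Y - NormedSpace.exp 0 - (Y - 0)) v := by
    simp only [NormedSpace.exp_zero, sub_zero, sub_apply,
      one_apply_eq_self, map_sub]
    abel
  rw [e, e2]
  have n0 : ‖(0 : Spinor →L[ℂ] Spinor)‖ = 0 := norm_zero
  rw [abs_of_pos hδ0] at *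
  have t1 : ‖(NormedSpace.exp X - NormedSpace.exp 0 - (X - 0)) (NormedSpace.exp Y v)‖
      ≤ ε / (4 * (B + 1)) * (δ * B) * ‖v‖ := by
    refine (ContinuousLinearMap.le_opNorm _ _).trans ?_
    rw [hY, norm_exp_op_apply hγ]
    gcongr
    refine (hexp X 0 (bX.trans hδ₂) (by rw [n0]; exact hr.le)).trans ?_
    rw [sub_zero]; gcongr
  have t3 : ‖(NormedSpace.exp Y - NormedSpace.exp 0 - (Y - 0)) v‖
      ≤ ε / (4 * (B + 1)) * (δ * B) * ‖v‖ := by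
    refine (ContinuousLinearMap.le_opNorm _ _).trans ?_
    gcongr
    refine (hexp Y 0 (bY.trans hδ₂) (by rw [n0]; exact hr.le)).trans ?_
    rw [sub_zero]; gcongr
  have t2 : ‖X ((NormedSpace.exp Y - NormedSpace.exp 0) v)‖
      ≤ (δ * B) * (2 * (ε / (4 * (B + 1)))) * ‖v‖ := by
    refine (ContinuousLinearMap.le_opNorm _ _).trans ?_
    rw [mul_assoc]
    gcongr
    refine (ContinuousLinearMap.le_opNorm _ _).trans ?_
    gcongr
    refine (norm_exp_sub_le_of hexp₁ (bY.trans hδ₁) (by rw [n0]; exact hr₁.le)).trans ?_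
    rw [sub_zero]
    linarith
  refine (norm_add₃_le).trans ((add_le_add_three t1 t2 t3).trans ?_)
  have hq : 4 * (ε / (4 * (B + 1))) * B ≤ ε := by
    have : 4 * (ε / (4 * (B + 1))) * B = ε * (B / (B + 1)) := by field_simp
    rw [this]
    exact mul_le_of_le_one_right hε.le ((div_le_one (by positivity)).2 (by linarith))
  calc _ = (4 * (ε / (4 * (B + 1))) * B) * δ * ‖v‖ := by ring
    _ ≤ _ := by gcongr

end NLQW
end

/-! ### Translations, weak derivatives and the free flow on `L²`. -/

noncomputable section

namespace NLQW

/-! ### Norms in `L²` -/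

theorem norm_sq_eq_integral (f : L2) : ‖f‖ ^ 2 = ∫ x, ‖f x‖ ^ 2 := by
  have h := congr_arg RCLike.re (L2.inner_def (𝕜 := ℂ) f f)
  rw [← integral_re (L2.integrable_inner f f)] at h
  simpa only [← norm_sq_eq_re_inner] using h

theorem integrable_norm_sq (f : L2) : Integrable fun x => ‖f x‖ ^ 2 :=
  (memLp_two_iff_integrable_sq_norm (Lp.aestronglyMeasurable f)).1 (Lp.memLp f)

/-- An almost everywhere pointwise bound by a combination of `L²` functions gives a norm bound. -/
theorem norm_le_add_mul_of_ae_le {f g h : L2} {c d : ℝ} (hc : 0 ≤ c) (hd : 0 ≤ d)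
    (H : ∀ᵐ x, ‖f x‖ ≤ c * ‖g x‖ + d * ‖h x‖) : ‖f‖ ≤ c * ‖g‖ + d * ‖h‖ := by
  have mg := ((Lp.memLp g).norm.const_mul c)
  have mh := ((Lp.memLp h).norm.const_mul d)
  have e : ‖(mg.add mh).toLp‖ ≤ c * ‖g‖ + d * ‖h‖ := by
    rw [MemLp.toLp_add mg mh]
    refine (norm_add_le _ _).trans (add_le_add ?_ ?_)
    · refine Lp.norm_le_mul_norm_of_ae_le_mul ?_
      filter_upwards [mg.coeFn_toLp] with x hx
      rw [hx, Real.norm_of_nonneg (by positivity)]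
    · refine Lp.norm_le_mul_norm_of_ae_le_mul ?_
      filter_upwards [mh.coeFn_toLp] with x hx
      rw [hx, Real.norm_of_nonneg (by positivity)]
  refine le_trans (Lp.norm_le_norm_of_ae_le ?_) e
  filter_upwards [H, (mg.add mh).coeFn_toLp] with x hx h2
  rw [h2, Pi.add_apply]
  exact hx.trans (le_abs_self _)

/-! ### Translations -/

/-- Translation by `r` on `L²`: `(trans r f)(x) = f (x - r)`. -/
def trans (r : ℝ) : L2 →ₗᵢ[ℂ] L2 :=
  Lp.compMeasurePreservingₗᵢ ℂ (fun x => x - r) (measurePreserving_sub_right volume r)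

theorem coeFn_trans (r : ℝ) (f : L2) : trans r f =ᵐ[volume] fun x => f (x - r) :=
  Lp.coeFn_compMeasurePreserving f (measurePreserving_sub_right volume r)

theorem ae_comp_sub {p : ℝ → Prop} (h : ∀ᵐ x, p x) (r : ℝ) : ∀ᵐ x : ℝ, p (x - r) :=
  (measurePreserving_sub_right volume r).quasiMeasurePreserving.ae h

theorem trans_trans (r s : ℝ) (f : L2) : trans r (trans s f) = trans (r + s) f := by
  ext1
  filter_upwards [coeFn_trans r (trans s f), ae_comp_sub (coeFn_trans s f) r,
    coeFn_trans (r + s) f] with x h1 h2 h3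
  rw [h1, h2, h3, sub_sub]

theorem trans_zero (f : L2) : trans 0 f = f := by
  ext1
  filter_upwards [coeFn_trans 0 f] with x h1
  rw [h1, sub_zero]

/-- Translations are strongly but not norm continuous in `r`; joint continuity in `(r, f)` is the
substitute used when both the flow and the function it acts on depend on time. -/
theorem continuous_trans : Continuous fun p : ℝ × L2 => trans p.1 p.2 := by
  let g : ℝ × L2 → C(ℝ, ℝ) := fun p => ⟨fun x => x - p.1, by fun_prop⟩
  have hg : Continuous g := by
    refine ContinuousMap.continuous_of_continuous_uncurry _ ?_
    change Continuous fun q : (ℝ × L2) × ℝ => q.2 - q.1.1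
    fun_prop
  exact Continuous.compMeasurePreservingLp (f := fun p : ℝ × L2 => p.2) continuous_snd hg
    (fun p => measurePreserving_sub_right volume p.1) (by simp)

/-- The character `η ↦ exp (-2πi r η)`. -/
def phase (r η : ℝ) : ℂ := Complex.exp (Complex.I * ((-(2 * Real.pi * r * η) : ℝ) : ℂ))

theorem norm_phase (r η : ℝ) : ‖phase r η‖ = 1 := by
  rw [phase, mul_comm, Complex.norm_exp_ofReal_mul_I]

theorem continuous_phase (r : ℝ) : Continuous (phase r) := by
  unfold phase; fun_prop

theorem memLp_phase_smul (r : ℝ) (f : L2) : MemLp (fun η => phase r η • f η) 2 volume := by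
  refine (Lp.memLp f).of_le
    ((continuous_phase r).aestronglyMeasurable.smul (Lp.aestronglyMeasurable f)) ?_
  filter_upwards with η
  rw [norm_smul, norm_phase, one_mul]

theorem norm_phase_smul_sub (r : ℝ) (f g : L2) :
    ‖(memLp_phase_smul r f).toLp - (memLp_phase_smul r g).toLp‖ = ‖f - g‖ := by
  refine le_antisymm (Lp.norm_le_norm_of_ae_le ?_) (Lp.norm_le_norm_of_ae_le ?_) <;>
  filter_upwards [Lp.coeFn_sub (memLp_phase_smul r f).toLp (memLp_phase_smul r g).toLp,
    (memLp_phase_smul r f).coeFn_toLp, (memLp_phase_smul r g).coeFn_toLp,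
    Lp.coeFn_sub f g] with x h1 h2 h3 h4 <;>
  rw [h1, h4, Pi.sub_apply, Pi.sub_apply, h2, h3, ← smul_sub, norm_smul, norm_phase, one_mul]

theorem fourier_trans_schwartz (r : ℝ) (φ : 𝓢(ℝ, Spinor)) (η : ℝ) :
    𝓕 (φ.compSubConstCLM ℂ r) η = phase r η • 𝓕 φ η := by
  rw [SchwartzMap.fourier_coe, SchwartzMap.fourier_coe, Real.fourier_real_eq_integral_exp_smul,
    Real.fourier_real_eq_integral_exp_smul, ← integral_smul]
  rw [← integral_sub_right_eq_self (fun x => phase r η • _ • φ x) r]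
  congr 1
  ext1 x
  rw [SchwartzMap.compSubConstCLM_apply, smul_smul, phase, ← Complex.exp_add]
  congr 2
  push_cast
  ring

theorem trans_toLp (r : ℝ) (φ : 𝓢(ℝ, Spinor)) :
    trans r (φ.toLp 2) = (φ.compSubConstCLM ℂ r).toLp 2 := by
  ext1
  filter_upwards [coeFn_trans r (φ.toLp 2), ae_comp_sub (φ.coeFn_toLp 2 volume) r,
    (φ.compSubConstCLM ℂ r).coeFn_toLp 2 volume] with x h1 h2 h3
  rw [h1, h2, h3, SchwartzMap.compSubConstCLM_apply]

/-- Both sides are continuous in `f` and agree on the dense set of Schwartz functions, where the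
Fourier integral can be shifted. -/
theorem fourier_trans (r : ℝ) (f : L2) : (𝓕 (trans r f) : L2) = (memLp_phase_smul r (𝓕 f)).toLp := by
  have hd := SchwartzMap.denseRange_toLpCLM (F := Spinor) (p := 2) (μ := (volume : Measure ℝ))
    ENNReal.ofNat_ne_top
  refine DenseRange.induction_on
    (p := fun f : L2 => (𝓕 (trans r f) : L2) = (memLp_phase_smul r (𝓕 f)).toLp) hd f ?_ ?_
  · refine isClosed_eq ?_ ?_
    · exact (Lp.fourierTransformₗᵢ ℝ Spinor).continuous.comp (trans r).continuous
    · have : Isometry fun f : L2 => (memLp_phase_smul r f).toLp :=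
        Isometry.of_dist_eq fun f g => by
          rw [dist_eq_norm, dist_eq_norm, norm_phase_smul_sub]
      exact this.continuous.comp (Lp.fourierTransformₗᵢ ℝ Spinor).continuous
  · intro φ
    rw [SchwartzMap.toLpCLM_apply, trans_toLp, SchwartzMap.toLp_fourier_eq]
    ext1
    filter_upwards [(𝓕 (φ.compSubConstCLM ℂ r)).coeFn_toLp 2 volume,
      (memLp_phase_smul r (𝓕 (φ.toLp 2 : L2))).coeFn_toLp,
      (𝓕 φ).coeFn_toLp 2 volume] with η h1 h2 h3
    rw [h1, h2, fourier_trans_schwartz, SchwartzMap.toLp_fourier_eq, h3]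

theorem coeFn_fourier_trans (r : ℝ) (f : L2) :
    (𝓕 (trans r f) : L2) =ᵐ[volume] fun η => phase r η • (𝓕 f : L2) η := by
  rw [fourier_trans]
  exact (memLp_phase_smul r (𝓕 f)).coeFn_toLp

/-! ### Weak derivatives -/

theorem toTemperedDistribution_injective {f g : L2} (h : (f : 𝓢'(ℝ, Spinor)) = g) : f = g := by
  have hk := Lp.ker_toTemperedDistributionCLM_eq_bot (F := Spinor) (μ := (volume : Measure ℝ))
    (p := 2)
  exact LinearMap.ker_eq_bot.1 hk h

theorem IsWeakDeriv.unique {j : ℕ} {f g h : L2} (hg : IsWeakDeriv j f g) (hh : IsWeakDeriv j f h) :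
    g = h :=
  toTemperedDistribution_injective (hg.symm.trans hh)

theorem IsWeakDeriv.weakDeriv_eq {j : ℕ} {f g : L2} (hg : IsWeakDeriv j f g) :
    weakDeriv j f = g := by
  have h : ∃ v, IsWeakDeriv j f v := ⟨g, hg⟩
  rw [weakDeriv, dif_pos h]
  exact h.choose_spec.unique hg

theorem MemH.isWeakDeriv {k j : ℕ} {f : L2} (h : MemH k f) (hj : j ≤ k) :
    IsWeakDeriv j f (weakDeriv j f) := by
  obtain ⟨g, hg⟩ := h j hj
  rwa [hg.weakDeriv_eq]

theorem isWeakDeriv_one_iff {f g : L2} :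
    IsWeakDeriv 1 f g ↔ ∂_{(1 : ℝ)} (f : 𝓢'(ℝ, Spinor)) = g := Iff.rfl

theorem toTemperedDistribution_sub (f g : L2) :
    ((f - g : L2) : 𝓢'(ℝ, Spinor)) = (f : 𝓢'(ℝ, Spinor)) - g :=
  map_sub (Lp.toTemperedDistributionCLM Spinor (volume : Measure ℝ) 2) f g

theorem IsWeakDeriv.sub {f g f' g' : L2} (hf : IsWeakDeriv 1 f f') (hg : IsWeakDeriv 1 g g') :
    IsWeakDeriv 1 (f - g) (f' - g') := by
  rw [isWeakDeriv_one_iff] at *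
  rw [toTemperedDistribution_sub, toTemperedDistribution_sub, ← hf, ← hg]
  exact map_sub (LineDeriv.lineDerivOpCLM ℂ 𝓢'(ℝ, Spinor) (1 : ℝ)) _ _

/-- The identity holds between tempered distributions; testing it against compactly supported smooth
functions gives equality almost everywhere, since both sides are locally integrable. -/
theorem IsWeakDeriv.fourier_eq {f g : L2} (h : IsWeakDeriv 1 f g) :
    (𝓕 g : L2) =ᵐ[volume] fun η : ℝ => (2 * Real.pi * Complex.I * η) • (𝓕 f : L2) η := by
  rw [isWeakDeriv_one_iff] at h
  have h2 := congr_arg (fun S : 𝓢'(ℝ, Spinor) => 𝓕 S) h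
  simp only [TemperedDistribution.fourier_lineDerivOp_eq,
    Lp.fourier_toTemperedDistribution_eq] at h2
  refine ae_eq_of_integral_contDiff_smul_eq ((Lp.memLp (𝓕 g : L2)).locallyIntegrable (by simp))
    ?_ fun φ hφ hφc => ?_
  · refine LocallyIntegrable.continuous_smul ?_ (f := (𝓕 f : L2)) 
      ((Lp.memLp (𝓕 f : L2)).locallyIntegrable (by simp))
    fun_prop
  · have hφ₁ : HasCompactSupport (Complex.ofRealCLM ∘ φ) := hφc.comp_left rfl
    have hφ₂ : ContDiff ℝ ∞ (Complex.ofRealCLM ∘ φ) := by fun_prop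
    have h3 := congr_arg (fun S : 𝓢'(ℝ, Spinor) => S (hφ₁.toSchwartzMap hφ₂)) h2
    have ht : (fun x : ℝ => ((inner ℝ x (1 : ℝ) : ℝ) : ℂ)).HasTemperateGrowth := by fun_prop
    simp only [TemperedDistribution.smulLeftCLM_apply_apply, smul_apply,
      Lp.toTemperedDistribution_apply, SchwartzMap.smulLeftCLM_apply_apply ht] at h3
    rw [← integral_smul] at h3
    have e : ∀ x : ℝ, (hφ₁.toSchwartzMap hφ₂) x = (φ x : ℂ) := fun _ => rfl
    calc _ = ∫ x, (φ x : ℂ) • (𝓕 g : L2) x := by simp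
      _ = _ := by
        simp only [e] at h3
        rw [← h3]
        refine integral_congr_ae (Eventually.of_forall fun x => ?_)
        simp only [smul_smul, ← Complex.coe_smul]
        congr 1
        simp
        ring

theorem norm_phase_sub_one_le (r η : ℝ) : ‖phase r η - 1‖ ≤ 2 * Real.pi * |r| * |η| := by
  refine (Real.norm_exp_I_mul_ofReal_sub_one_le).trans (le_of_eq ?_)
  rw [norm_neg, norm_mul, norm_mul, Real.norm_of_nonneg (by positivity), Real.norm_eq_abs,
    Real.norm_eq_abs]

theorem hasDerivAt_phase (η : ℝ) :
    HasDerivAt (fun r => phase r η) (-(2 * Real.pi * Complex.I * η)) 0 := by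
  have h1 : HasDerivAt (fun r : ℝ => ((-(2 * Real.pi * r * η) : ℝ) : ℂ))
      (((-(2 * Real.pi * 1 * η) : ℝ) : ℂ)) 0 :=
    ((((hasDerivAt_id (0 : ℝ)).const_mul (2 * Real.pi)).mul_const η).neg).ofReal_comp
  have h2 := (h1.const_mul Complex.I).cexp
  refine h2.congr_deriv ?_
  simp
  ring

theorem real_smul_eq (t : ℝ) (f : L2) : t • f = (t : ℂ) • f := by
  ext1
  filter_upwards [Lp.coeFn_smul t f, Lp.coeFn_smul (t : ℂ) f] with x h1 h2
  rw [h1, h2, Pi.smul_apply, Pi.smul_apply, Complex.coe_smul]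

/-- A function with a weak derivative in `L²` is in the domain of the generator of translations. -/
theorem IsWeakDeriv.hasDerivAt_trans_zero {f g : L2} (h : IsWeakDeriv 1 f g) :
    HasDerivAt (fun r => trans r f) (-g) 0 := by
  rw [hasDerivAt_iff_tendsto_slope_zero, tendsto_iff_norm_sub_tendsto_zero]
  simp only [zero_add, trans_zero]
  -- By Plancherel the difference quotient becomes a multiplier acting on `𝓕 f`, to which dominated
  -- convergence applies.
  have key : ∀ t : ℝ, ‖t⁻¹ • (trans t f - f) - -g‖ ^ 2 =
      ∫ η, ‖(t⁻¹ • (phase t η - 1) + 2 * Real.pi * Complex.I * η) • (𝓕 f : L2) η‖ ^ 2 := by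
    intro t
    have e : (t⁻¹ • (trans t f - f) - -g) = (t⁻¹ : ℂ) • (trans t f - f) + g := by
      rw [sub_neg_eq_add, ← Complex.ofReal_inv, real_smul_eq]
    rw [e, ← Lp.norm_fourier_eq, norm_sq_eq_integral]
    refine integral_congr_ae ?_
    have e2 : (𝓕 ((t⁻¹ : ℂ) • (trans t f - f) + g) : L2)
        = (t⁻¹ : ℂ) • ((𝓕 (trans t f) : L2) - 𝓕 f) + 𝓕 g := by
      have := (Lp.fourierTransformₗᵢ ℝ Spinor).map_add ((t⁻¹ : ℂ) • (trans t f - f)) g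
      rw [LinearIsometryEquiv.map_smul, LinearIsometryEquiv.map_sub] at this
      exact this
    rw [e2]
    filter_upwards [Lp.coeFn_add ((t⁻¹ : ℂ) • ((𝓕 (trans t f) : L2) - 𝓕 f)) (𝓕 g),
      Lp.coeFn_smul (t⁻¹ : ℂ) ((𝓕 (trans t f) : L2) - 𝓕 f),
      Lp.coeFn_sub (𝓕 (trans t f) : L2) (𝓕 f), coeFn_fourier_trans t f, h.fourier_eq]
      with η h1 h2 h3 h4 h5
    rw [h1, Pi.add_apply, h2, Pi.smul_apply, h3, Pi.sub_apply, h4, h5, add_smul]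
    congr 3
    rw [← Complex.coe_smul, smul_eq_mul, mul_smul, sub_smul, one_smul, Complex.ofReal_inv]
  have lim : Tendsto (fun t : ℝ => ‖t⁻¹ • (trans t f - f) - -g‖ ^ 2) (𝓝[≠] 0) (𝓝 0) := by
    simp only [key]
    rw [show 𝓝 (0 : ℝ) = 𝓝 (∫ _ : ℝ, (0 : ℝ)) by simp]
    -- The multiplier is at most `2 · 2π|η|`, and `2π|η| ‖𝓕 f‖ = ‖𝓕 g‖` is square integrable.
    refine tendsto_integral_filter_of_dominated_convergence
      (fun η => (2 * ‖(𝓕 g : L2) η‖) ^ 2) ?_ ?_ ?_ ?_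
    · filter_upwards with t
      have hc : Continuous fun η : ℝ => t⁻¹ • (phase t η - 1) + 2 * Real.pi * Complex.I * η := by
        have := continuous_phase t
        fun_prop
      exact ((hc.aestronglyMeasurable.smul (Lp.aestronglyMeasurable _)).norm).pow 2
    · filter_upwards [self_mem_nhdsWithin] with t ht
      filter_upwards [h.fourier_eq] with η hη
      rw [Real.norm_of_nonneg (by positivity), hη, norm_smul, norm_smul, ← mul_assoc]
      gcongr
      have ht' : 0 < |t| := abs_pos.2 ht
      have n1 : ‖t⁻¹ • (phase t η - 1)‖ ≤ 2 * Real.pi * |η| := by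
        rw [norm_smul, norm_inv, Real.norm_eq_abs, inv_mul_le_iff₀ ht']
        refine (norm_phase_sub_one_le t η).trans (le_of_eq (by ring))
      have n2 : ‖(2 * Real.pi * Complex.I * η : ℂ)‖ = 2 * Real.pi * |η| := by
        simp [abs_of_pos Real.pi_pos]
      refine (norm_add_le _ _).trans ?_
      linarith
    · exact ((integrable_norm_sq (𝓕 g : L2)).const_mul (2 ^ 2)).congr
        (Eventually.of_forall fun η => (mul_pow _ _ _).symm)
    · filter_upwards with η
      have hd := (hasDerivAt_iff_tendsto_slope_zero.1 (hasDerivAt_phase η))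
      have p0 : phase 0 η = 1 := by simp [phase]
      simp only [zero_add, p0] at hd
      have := ((hd.add_const (2 * Real.pi * Complex.I * η)).smul_const ((𝓕 f : L2) η)).norm.pow 2
      simpa using this
  have := lim.sqrt
  simpa [Real.sqrt_sq] using this

theorem IsWeakDeriv.hasDerivAt_trans {f g : L2} (h : IsWeakDeriv 1 f g) (r : ℝ) :
    HasDerivAt (fun r => trans r f) (-trans r g) r := by
  have h1 : HasDerivAt (fun s => trans (s - r) f) (-g) r := by
    have := HasDerivAt.comp_sub_const r r (f := fun s => trans s f) (f' := -g)
      (by rw [sub_self]; exact h.hasDerivAt_trans_zero)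
    exact this
  have h2 := ((trans r).toContinuousLinearMap.restrictScalars ℝ).hasFDerivAt.comp_hasDerivAt r h1
  rw [← map_neg]
  refine h2.congr_of_eventuallyEq (Eventually.of_forall fun s => ?_)
  simp [trans_trans]

theorem IsWeakDeriv.norm_trans_sub_le {f g : L2} (h : IsWeakDeriv 1 f g) (r : ℝ) :
    ‖trans r f - f‖ ≤ ‖g‖ * |r| := by
  have := Convex.norm_image_sub_le_of_norm_hasDerivWithin_le (f := fun r => trans r f)
    (f' := fun r => -trans r g) (s := Set.univ) (x := 0) (y := r) (C := ‖g‖)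
    (fun x _ => (h.hasDerivAt_trans x).hasDerivWithinAt)
    (fun x _ => by rw [norm_neg, LinearIsometry.norm_map]) convex_univ trivial trivial
  simpa [trans_zero] using this

/-! ### The free evolution -/

/-- The `i`-th component of a spinor, as a spinor. -/
def component (i : Fin 2) : Spinor →L[ℂ] Spinor :=
  (EuclideanSpace.proj i : Spinor →L[ℂ] ℂ).smulRight (EuclideanSpace.single i 1)

theorem component_apply (i : Fin 2) (v : Spinor) (j : Fin 2) :
    component i v j = if j = i then v i else 0 := by
  simp [component]

/-- The `i`-th component of an `L²` spinor field. -/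
def part (i : Fin 2) : L2 →L[ℂ] L2 := (component i).compLpL 2 volume

theorem coeFn_part (i : Fin 2) (f : L2) : part i f =ᵐ[volume] fun x => component i (f x) :=
  (component i).coeFn_compLpL f

/-- The free Dirac evolution `(transport r f)(x) = (f₁(x - r), f₂(x + r))`. -/
def transport (r : ℝ) : L2 →L[ℂ] L2 :=
  (trans r).toContinuousLinearMap ∘L part 0 + (trans (-r)).toContinuousLinearMap ∘L part 1

theorem transport_apply (r : ℝ) (f : L2) :
    transport r f = trans r (part 0 f) + trans (-r) (part 1 f) := rfl

theorem coeFn_transport (r : ℝ) (f : L2) :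
    transport r f =ᵐ[volume] fun x => !₂[f (x - r) 0, f (x + r) 1] := by
  rw [transport_apply]
  filter_upwards [Lp.coeFn_add (trans r (part 0 f)) (trans (-r) (part 1 f)),
    coeFn_trans r (part 0 f), coeFn_trans (-r) (part 1 f), ae_comp_sub (coeFn_part 0 f) r,
    ae_comp_sub (coeFn_part 1 f) (-r)] with x h1 h2 h3 h4 h5
  rw [h1, Pi.add_apply, h2, h3, h4, h5]
  ext j
  fin_cases j <;> simp [component_apply]

theorem part_trans (i : Fin 2) (r : ℝ) (f : L2) : part i (trans r f) = trans r (part i f) := by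
  ext1
  filter_upwards [coeFn_part i (trans r f), coeFn_trans r f, coeFn_trans r (part i f),
    ae_comp_sub (coeFn_part i f) r] with x h1 h2 h3 h4
  rw [h1, h2, h3, h4]

theorem transport_trans (r s : ℝ) (f : L2) : transport r (trans s f) = trans s (transport r f) := by
  simp only [transport_apply, map_add, part_trans, trans_trans, add_comm]

theorem ae_comp_add {p : ℝ → Prop} (h : ∀ᵐ x, p x) (r : ℝ) : ∀ᵐ x : ℝ, p (x + r) := by
  simpa using ae_comp_sub h (-r)

theorem transport_transport (r s : ℝ) (f : L2) :
    transport r (transport s f) = transport (r + s) f := by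
  ext1
  filter_upwards [coeFn_transport r (transport s f), ae_comp_sub (coeFn_transport s f) r,
    ae_comp_add (coeFn_transport s f) r, coeFn_transport (r + s) f] with x h1 h2 h3 h4
  rw [h1, h2, h3, h4]
  simp [sub_sub, add_assoc]

theorem transport_zero (f : L2) : transport 0 f = f := by
  ext1
  filter_upwards [coeFn_transport 0 f] with x h1
  rw [h1]
  ext j
  fin_cases j <;> simp

/-- The two components, although shifted in opposite directions, remain pointwise orthogonal, and
each shift is isometric. -/
theorem norm_transport_sq (r : ℝ) (f : L2) :
    ‖transport r f‖ ^ 2 = ‖part 0 f‖ ^ 2 + ‖part 1 f‖ ^ 2 := by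
  have h : inner ℂ (trans r (part 0 f)) (trans (-r) (part 1 f)) = 0 := by
    rw [L2.inner_def]
    refine integral_eq_zero_of_ae ?_
    filter_upwards [coeFn_trans r (part 0 f), coeFn_trans (-r) (part 1 f),
      ae_comp_sub (coeFn_part 0 f) r, ae_comp_sub (coeFn_part 1 f) (-r)] with x h1 h2 h3 h4
    rw [h1, h2, h3, h4]
    simp [PiLp.inner_apply, component_apply]
  have := norm_add_sq_eq_norm_sq_add_norm_sq_of_inner_eq_zero _ _ h
  rw [LinearIsometry.norm_map, LinearIsometry.norm_map] at this
  rw [transport_apply, pow_two, pow_two, pow_two, this]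

theorem norm_transport (r : ℝ) (f : L2) : ‖transport r f‖ = ‖f‖ := by
  have h := (norm_transport_sq r f).trans (norm_transport_sq 0 f).symm
  rw [transport_zero] at h
  exact (pow_left_inj₀ (norm_nonneg _) (norm_nonneg _) two_ne_zero).1 h

theorem continuous_transport : Continuous fun p : ℝ × L2 => transport p.1 p.2 := by
  simp only [transport_apply]
  refine Continuous.add ?_ ?_
  · exact continuous_trans.comp (f := fun p : ℝ × L2 => (p.1, part 0 p.2)) (by fun_prop)
  · exact continuous_trans.comp (f := fun p : ℝ × L2 => (-p.1, part 1 p.2)) (by fun_prop)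

/-- The action of `σ₃`. -/
def sigmaThree : L2 →L[ℂ] L2 := part 0 - part 1

theorem coeFn_sigmaThree (f : L2) :
    sigmaThree f =ᵐ[volume] fun x => act (pauli 3) (f x) := by
  filter_upwards [Lp.coeFn_sub (part 0 f) (part 1 f), coeFn_part 0 f, coeFn_part 1 f]
    with x h1 h2 h3
  rw [sigmaThree, sub_apply, h1, Pi.sub_apply, h2, h3]
  ext j
  fin_cases j <;> simp [component_apply, act, pauli, dotProduct]

/-- The backward flow produces `+σ₃ ∂ₓ`, which will cancel the term `-σ₃ ∂ₓ u` of the Dirac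
equation. -/
theorem IsWeakDeriv.hasDerivAt_transport_neg {f g : L2} (h : IsWeakDeriv 1 f g) (r : ℝ) :
    HasDerivAt (fun r => transport (-r) f) (transport (-r) (sigmaThree g)) r := by
  have h0 : HasDerivAt (fun r => trans (-r) f) (trans (-r) g) r := by
    have := (h.hasDerivAt_trans (-r)).scomp r (hasDerivAt_neg r)
    exact this.congr_deriv (by simp)
  have h1 := ((part 0).restrictScalars ℝ).hasFDerivAt.comp_hasDerivAt r h0
  have h2 := ((part 1).restrictScalars ℝ).hasFDerivAt.comp_hasDerivAt r (h.hasDerivAt_trans r)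
  have h3 := h1.add h2
  have p00 : ∀ i f, part i (part i f) = part i f := by
    intro i f
    ext1
    filter_upwards [coeFn_part i (part i f), coeFn_part i f] with x h1 h2
    rw [h1, h2]
    ext j; simp [component_apply]
  have p01 : ∀ i j f, i ≠ j → part i (part j f) = 0 := by
    intro i j f hij
    ext1
    filter_upwards [coeFn_part i (part j f), coeFn_part j f,
      Lp.coeFn_zero Spinor 2 (volume : Measure ℝ)] with x h1 h2 h3
    rw [h1, h2, h3]
    ext k; simp [component_apply, hij]
  refine (h3.congr_deriv ?_).congr_of_eventuallyEq (Eventually.of_forall fun s => ?_)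
  · simp [transport_apply, sigmaThree, part_trans, p00, p01]
  · simp [transport_apply, part_trans]

end NLQW
end

/-! ### Shannon interpolation and its inverse through Fourier series. -/

noncomputable section

namespace NLQW

/-! ### Fourier series on the band -/

/-- The `n`-th Fourier coefficient on the band. -/
def bandCoeff (δ : ℝ) (F : L2) (n : ℤ) : Spinor :=
  ∫ η in band δ, Complex.exp (2 * Real.pi * Complex.I * (δ * n * η)) • F η

theorem shannonInv_eq (δ : ℝ) (f : L2) : shannonInv δ f = bandCoeff δ (𝓕 f) := rfl

theorem isFiniteMeasure_restrict_band (δ : ℝ) : IsFiniteMeasure (volume.restrict (band δ)) := by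
  unfold band; infer_instance

theorem norm_exp_two_pi_I_mul (x : ℝ) : ‖Complex.exp (2 * Real.pi * Complex.I * x)‖ = 1 := by
  have h : (2 * Real.pi * Complex.I * x : ℂ) = ((2 * Real.pi * x : ℝ) : ℂ) * Complex.I := by
    push_cast; ring
  rw [h, Complex.norm_exp_ofReal_mul_I]

theorem measurableSet_band (δ : ℝ) : MeasurableSet (band δ) := measurableSet_Icc

theorem integrableOn_band (δ : ℝ) (F : L2) : IntegrableOn F (band δ) := by
  have := isFiniteMeasure_restrict_band δ
  exact (((Lp.memLp F).restrict (band δ))).integrable (by norm_num)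

theorem integrableOn_bandCoeff (δ : ℝ) (F : L2) (n : ℤ) :
    IntegrableOn (fun η : ℝ => Complex.exp (2 * Real.pi * Complex.I * (δ * n * η)) • F η)
      (band δ) := by
  refine Integrable.bdd_smul (𝕜 := ℂ) (C := 1) (integrableOn_band δ F) ?_ ?_
  · exact Continuous.aestronglyMeasurable (by fun_prop)
  · filter_upwards with η
    have := norm_exp_two_pi_I_mul (δ * n * η)
    push_cast at this
    exact this.le

theorem bandCoeff_sub (δ : ℝ) (F H : L2) (n : ℤ) :
    bandCoeff δ (F - H) n = bandCoeff δ F n - bandCoeff δ H n := by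
  rw [bandCoeff, bandCoeff, bandCoeff,
    ← integral_sub (integrableOn_bandCoeff δ F n) (integrableOn_bandCoeff δ H n)]
  refine integral_congr_ae (ae_restrict_of_ae ?_)
  filter_upwards [Lp.coeFn_sub F H] with η h
  rw [h, Pi.sub_apply, smul_sub]

theorem bandCoeff_congr {δ : ℝ} {F H : L2} (h : ∀ᵐ η, η ∈ band δ → F η = H η) (n : ℤ) :
    bandCoeff δ F n = bandCoeff δ H n := by
  refine setIntegral_congr_ae measurableSet_Icc ?_
  filter_upwards [h] with η h1 h2
  rw [h1 h2]

theorem coeFn_latticeMode (δ : ℝ) (n : ℤ) (c : Spinor) :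
    latticeMode δ n c =ᵐ[volume] (band δ).indicator fun η : ℝ =>
      ((δ : ℂ) * Complex.exp (-(2 * Real.pi * Complex.I * (δ * n * η)))) • c :=
  (memLp_latticeMode δ n c).coeFn_toLp

/-- The conjugate of a mode is the kernel of the band coefficient, and the factor `δ` is the
normalization of the mode. Orthogonality, norms and completeness of the modes all come from this
formula. -/
theorem inner_latticeMode (δ : ℝ) (n : ℤ) (c : Spinor) (F : L2) :
    inner ℂ (latticeMode δ n c) F = δ * inner ℂ c (bandCoeff δ F n) := by
  rw [L2.inner_def, bandCoeff, ← integral_inner (integrableOn_bandCoeff δ F n),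
    ← integral_const_mul, ← integral_indicator (measurableSet_band δ)]
  refine integral_congr_ae ?_
  filter_upwards [coeFn_latticeMode δ n c] with η h
  rw [h]
  by_cases hη : η ∈ band δ
  · have e : (starRingEnd ℂ) (Complex.exp (-(2 * Real.pi * Complex.I * (δ * n * η))))
        = Complex.exp (2 * Real.pi * Complex.I * (δ * n * η)) := by
      rw [← Complex.exp_conj]
      simp [Complex.conj_ofNat]
    rw [Set.indicator_of_mem hη, Set.indicator_of_mem (by exact hη), inner_smul_left,
      inner_smul_right, map_mul, e]
    simp
    ring
  · rw [Set.indicator_of_notMem hη, Set.indicator_of_notMem (by exact hη), inner_zero_left]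

theorem integral_band_exp {δ : ℝ} (hδ : 0 < δ) (k : ℤ) :
    ∫ η in band δ, Complex.exp (2 * Real.pi * Complex.I * (δ * k * η))
      = if k = 0 then (δ : ℂ)⁻¹ else 0 := by
  have hle : -(1 / (2 * δ)) ≤ 1 / (2 * δ) := by
    have : 0 < 1 / (2 * δ) := by positivity
    linarith
  rw [band, integral_Icc_eq_integral_Ioc, ← intervalIntegral.integral_of_le hle]
  have hδ' : (δ : ℂ) ≠ 0 := by exact_mod_cast hδ.ne'
  split_ifs with hk
  · subst hk
    simp
    field_simp
    norm_num
  · have hc : (2 * Real.pi * Complex.I * (δ * k) : ℂ) ≠ 0 := by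
      have : (k : ℂ) ≠ 0 := by exact_mod_cast hk
      have := Real.pi_ne_zero
      simp [*]
    have e : ∀ η : ℝ, (2 * Real.pi * Complex.I * (δ * k * η) : ℂ)
        = (2 * Real.pi * Complex.I * (δ * k)) * η := fun η => by ring
    simp only [e]
    rw [integral_exp_mul_complex hc, div_eq_zero_iff]
    left
    -- Across the band, of length `1/δ`, the exponent changes by `2πik`, so both endpoints give the
    -- same value.
    rw [sub_eq_zero, Complex.exp_eq_exp_iff_exists_int]
    refine ⟨k, ?_⟩
    push_cast
    field_simp
    ring

theorem bandCoeff_latticeMode {δ : ℝ} (hδ : 0 < δ) (m n : ℤ) (c : Spinor) :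
    bandCoeff δ (latticeMode δ m c) n = if m = n then c else 0 := by
  have e : bandCoeff δ (latticeMode δ m c) n
      = ∫ η in band δ, ((δ : ℂ) *
        Complex.exp (2 * Real.pi * Complex.I * (δ * (n - m : ℤ) * η))) • c := by
    refine setIntegral_congr_ae measurableSet_Icc ?_
    filter_upwards [coeFn_latticeMode δ m c] with η h hη
    rw [h, Set.indicator_of_mem hη, smul_smul]
    congr 1
    rw [mul_left_comm, ← Complex.exp_add]
    congr 2
    push_cast
    ring
  rw [e, integral_smul_const, integral_const_mul, integral_band_exp hδ]
  have hδ' : (δ : ℂ) ≠ 0 := by exact_mod_cast hδ.ne'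
  by_cases h : m = n
  · simp [h, hδ']
  · rw [if_neg h, if_neg (by omega)]
    simp

theorem norm_sq_latticeMode {δ : ℝ} (hδ : 0 < δ) (n : ℤ) (c : Spinor) :
    ‖latticeMode δ n c‖ ^ 2 = δ * ‖c‖ ^ 2 := by
  have h := inner_latticeMode δ n c (latticeMode δ n c)
  rw [bandCoeff_latticeMode hδ, if_pos rfl, inner_self_eq_norm_sq_to_K,
    inner_self_eq_norm_sq_to_K] at h
  exact Complex.ofReal_injective (by push_cast; exact h)

theorem latticeMode_add (δ : ℝ) (n : ℤ) (c d : Spinor) :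
    latticeMode δ n (c + d) = latticeMode δ n c + latticeMode δ n d := by
  ext1
  filter_upwards [coeFn_latticeMode δ n (c + d), coeFn_latticeMode δ n c, coeFn_latticeMode δ n d,
    Lp.coeFn_add (latticeMode δ n c) (latticeMode δ n d)] with η h1 h2 h3 h4
  rw [h1, h4, Pi.add_apply, h2, h3]
  by_cases hη : η ∈ band δ
  · simp only [Set.indicator_of_mem hη, smul_add]
  · simp only [Set.indicator_of_notMem hη, add_zero]

theorem latticeMode_smul (δ : ℝ) (n : ℤ) (z : ℂ) (c : Spinor) :
    latticeMode δ n (z • c) = z • latticeMode δ n c := by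
  ext1
  filter_upwards [coeFn_latticeMode δ n (z • c), coeFn_latticeMode δ n c,
    Lp.coeFn_smul z (latticeMode δ n c)] with η h1 h2 h3
  rw [h1, h3, Pi.smul_apply, h2]
  by_cases hη : η ∈ band δ
  · simp only [Set.indicator_of_mem hη]
    rw [smul_comm]
  · simp only [Set.indicator_of_notMem hη, smul_zero]

/-- The normalized lattice modes. -/
def latticeIsometry {δ : ℝ} (hδ : 0 < δ) (n : ℤ) : Spinor →ₗᵢ[ℂ] L2 where
  toFun c := (((√δ)⁻¹ : ℝ) : ℂ) • latticeMode δ n c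
  map_add' c d := by rw [latticeMode_add, smul_add]
  map_smul' z c := by rw [latticeMode_smul, smul_comm]; rfl
  norm_map' c := by
    change ‖(((√δ)⁻¹ : ℝ) : ℂ) • latticeMode δ n c‖ = ‖c‖
    rw [← pow_left_inj₀ (norm_nonneg _) (norm_nonneg _) two_ne_zero, norm_smul, mul_pow,
      norm_sq_latticeMode hδ, Complex.norm_real, norm_inv, inv_pow, Real.norm_eq_abs, sq_abs,
      Real.sq_sqrt hδ.le, inv_mul_cancel_left₀ hδ.ne']

theorem latticeIsometry_apply {δ : ℝ} (hδ : 0 < δ) (n : ℤ) (c : Spinor) :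
    latticeIsometry hδ n c = (((√δ)⁻¹ : ℝ) : ℂ) • latticeMode δ n c := rfl

theorem orthogonalFamily_latticeIsometry {δ : ℝ} (hδ : 0 < δ) :
    OrthogonalFamily ℂ (fun _ : ℤ => Spinor) (latticeIsometry hδ) := by
  intro m n hmn c d
  change inner ℂ (latticeIsometry hδ m c) (latticeIsometry hδ n d) = 0
  rw [latticeIsometry_apply, latticeIsometry_apply, inner_smul_left, inner_smul_right,
    inner_latticeMode, bandCoeff_latticeMode hδ, if_neg (Ne.symm hmn)]
  simp

variable {δ : ℝ} {w w' : ℤ → Spinor}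

theorem memlp_smul (hw : Summable fun n => ‖w n‖ ^ 2) :
    Memℓp (fun n => ((√δ : ℝ) : ℂ) • w n) 2 := by
  rw [memℓp_gen_iff (by simp)]
  simp only [ENNReal.toReal_ofNat, Real.rpow_ofNat, norm_smul, mul_pow]
  exact hw.mul_left _

theorem latticeMode_eq_latticeIsometry (hδ : 0 < δ) (n : ℤ) (c : Spinor) :
    latticeIsometry hδ n (((√δ : ℝ) : ℂ) • c) = latticeMode δ n c := by
  rw [map_smul, latticeIsometry_apply, smul_smul, ← Complex.ofReal_mul,
    mul_inv_cancel₀ (Real.sqrt_pos.2 hδ).ne', Complex.ofReal_one, one_smul]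

/-- After division by `√δ` the modes form an orthogonal family of isometries, so square summability
suffices. Genuine convergence matters because the `∑'` in `discreteFourier` would otherwise default
to `0`. -/
theorem hasSum_latticeMode (hδ : 0 < δ) (hw : Summable fun n => ‖w n‖ ^ 2) :
    HasSum (fun n => latticeMode δ n (w n)) (discreteFourier δ w) := by
  have h := (orthogonalFamily_latticeIsometry hδ).hasSum_linearIsometry
    ⟨_, memlp_smul (δ := δ) hw⟩
  simp only [latticeMode_eq_latticeIsometry] at h
  exact h.summable.hasSum

theorem norm_sq_discreteFourier (hδ : 0 < δ) (hw : Summable fun n => ‖w n‖ ^ 2) :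
    ‖discreteFourier δ w‖ ^ 2 = δ * ∑' n, ‖w n‖ ^ 2 := by
  have h := (orthogonalFamily_latticeIsometry hδ).hasSum_linearIsometry
    ⟨_, memlp_smul (δ := δ) hw⟩
  simp only [latticeMode_eq_latticeIsometry] at h
  rw [(hasSum_latticeMode hδ hw).unique h, LinearIsometry.norm_map,
    ← Real.rpow_two]
  have := lp.norm_rpow_eq_tsum (p := 2) (by simp) (⟨_, memlp_smul (δ := δ) hw⟩ : lp (fun _ : ℤ => Spinor) 2)
  simp only [ENNReal.toReal_ofNat] at this
  rw [this, ← tsum_mul_left]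
  refine tsum_congr fun n => ?_
  rw [norm_smul, Complex.norm_real, Real.norm_eq_abs, Real.rpow_two, mul_pow, sq_abs,
    Real.sq_sqrt hδ.le]

theorem summable_norm_sq_sub (hw : Summable fun n => ‖w n‖ ^ 2)
    (hw' : Summable fun n => ‖w' n‖ ^ 2) : Summable fun n => ‖w n - w' n‖ ^ 2 := by
  refine Summable.of_nonneg_of_le (fun n => by positivity) (fun n => ?_)
    ((hw.add hw').mul_left 2)
  have := norm_sub_le (w n) (w' n)
  nlinarith [sq_nonneg (‖w n‖ - ‖w' n‖), norm_nonneg (w n - w' n), norm_nonneg (w n),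
    norm_nonneg (w' n)]

theorem latticeMode_sub (δ : ℝ) (n : ℤ) (c d : Spinor) :
    latticeMode δ n (c - d) = latticeMode δ n c - latticeMode δ n d := by
  rw [eq_sub_iff_add_eq, ← latticeMode_add, sub_add_cancel]

/-- The Shannon interpolation is an isometry. -/
theorem norm_sq_shannon_sub (hδ : 0 < δ) (hw : Summable fun n => ‖w n‖ ^ 2)
    (hw' : Summable fun n => ‖w' n‖ ^ 2) :
    ‖shannon δ w - shannon δ w'‖ ^ 2 = δ * ∑' n, ‖w n - w' n‖ ^ 2 := by
  have e : shannon δ w - shannon δ w' = shannon δ (fun n => w n - w' n) := by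
    have h1 := (hasSum_latticeMode hδ hw).sub (hasSum_latticeMode hδ hw')
    simp only [← latticeMode_sub] at h1
    have h2 := (hasSum_latticeMode hδ (summable_norm_sq_sub hw hw')).unique h1
    rw [shannon, shannon, shannon, h2]
    exact ((Lp.fourierTransformₗᵢ ℝ Spinor).symm.map_sub _ _).symm
  rw [e, shannon, ← norm_sq_discreteFourier hδ (summable_norm_sq_sub hw hw')]
  congr 1
  exact (Lp.fourierTransformₗᵢ ℝ Spinor).symm.norm_map _

theorem bandCoeff_apply (δ : ℝ) (F : L2) (n : ℤ) (i : Fin 2) :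
    bandCoeff δ F n i
      = ∫ η in band δ, Complex.exp (2 * Real.pi * Complex.I * (δ * n * η)) • F η i := by
  have := (EuclideanSpace.proj i : Spinor →L[ℂ] ℂ).integral_comp_comm (integrableOn_bandCoeff δ F n)
  rw [bandCoeff]
  simpa using this.symm

theorem hasSum_norm_sq_bandCoeff_apply (hδ : 0 < δ) (F : L2) (i : Fin 2) :
    HasSum (fun n => δ * ‖bandCoeff δ F n i‖ ^ 2) (∫ η in band δ, ‖F η i‖ ^ 2) := by
  have hlt : -(1 / (2 * δ)) < 1 / (2 * δ) := by
    have : 0 < 1 / (2 * δ) := by positivity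
    linarith
  have hm : MemLp (fun η => F η i) 2 (volume.restrict (Set.Ioc (-(1 / (2 * δ))) (1 / (2 * δ)))) :=
    (((EuclideanSpace.proj i : Spinor →L[ℂ] ℂ).comp_memLp' (Lp.memLp F))).restrict _
  have h := hasSum_sq_fourierCoeffOn hlt hm
  have hlen : 1 / (2 * δ) - -(1 / (2 * δ)) = δ⁻¹ := by field_simp; norm_num
  rw [hlen, inv_inv, intervalIntegral.integral_of_le hlt.le, ← integral_Icc_eq_integral_Ioc] at h
  have h2 := ((Equiv.neg ℤ).hasSum_iff.2 h).mul_left δ⁻¹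
  rw [smul_eq_mul, inv_mul_cancel_left₀ hδ.ne'] at h2
  refine h2.congr_fun ?_
  intro n
  -- Fourier coefficients use the character with the opposite sign, hence the reindexing `n ↦ -n`.
  have e : fourierCoeffOn hlt (fun η => F η i) (-n) = (δ : ℂ) * bandCoeff δ F n i := by
    rw [fourierCoeffOn_eq_integral, bandCoeff_apply, band, integral_Icc_eq_integral_Ioc,
      ← intervalIntegral.integral_of_le hlt.le, hlen, one_div, inv_inv, Complex.real_smul]
    congr 1
    refine intervalIntegral.integral_congr fun η _ => ?_
    simp only [neg_neg, fourier_coe_apply]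
    congr 2
    push_cast
    rw [div_inv_eq_mul]
    ring
  simp only [Function.comp_apply, Equiv.neg_apply]
  rw [e, norm_mul, Complex.norm_real, Real.norm_of_nonneg hδ.le]
  field_simp

theorem hasSum_norm_sq_bandCoeff (hδ : 0 < δ) (F : L2) :
    HasSum (fun n => δ * ‖bandCoeff δ F n‖ ^ 2) (∫ η in band δ, ‖F η‖ ^ 2) := by
  have h := (hasSum_norm_sq_bandCoeff_apply hδ F 0).add (hasSum_norm_sq_bandCoeff_apply hδ F 1)
  have hi : ∀ i, IntegrableOn (fun η => ‖F η i‖ ^ 2) (band δ) := fun i => by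
    have hm := ((EuclideanSpace.proj i : Spinor →L[ℂ] ℂ).comp_memLp' (Lp.memLp F))
    exact ((memLp_two_iff_integrable_sq_norm hm.1).1 hm).integrableOn
  rw [← integral_add (hi 0) (hi 1)] at h
  convert h using 1
  · ext n
    rw [EuclideanSpace.norm_sq_eq, Fin.sum_univ_two]; ring
  · congr 1
    ext η
    rw [EuclideanSpace.norm_sq_eq, Fin.sum_univ_two]

theorem summable_norm_sq_shannonInv (hδ : 0 < δ) (f : L2) :
    Summable fun n => ‖shannonInv δ f n‖ ^ 2 := by
  have := (hasSum_norm_sq_bandCoeff hδ (𝓕 f)).summable.mul_left δ⁻¹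
  simpa [shannonInv_eq, hδ.ne'] using this

theorem tsum_norm_sq_shannonInv_le (hδ : 0 < δ) (f : L2) :
    δ * ∑' n, ‖shannonInv δ f n‖ ^ 2 ≤ ‖f‖ ^ 2 := by
  rw [← tsum_mul_left, shannonInv_eq, (hasSum_norm_sq_bandCoeff hδ (𝓕 f)).tsum_eq,
    ← Lp.norm_fourier_eq, norm_sq_eq_integral]
  exact setIntegral_le_integral (integrable_norm_sq _) (Eventually.of_forall fun _ => by positivity)

theorem shannonInv_sub (δ : ℝ) (f h : L2) (n : ℤ) :
    shannonInv δ (f - h) n = shannonInv δ f n - shannonInv δ h n := by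
  have e : (𝓕 (f - h) : L2) = 𝓕 f - 𝓕 h := (Lp.fourierTransformₗᵢ ℝ Spinor).map_sub f h
  rw [shannonInv_eq, e, bandCoeff_sub]
  rfl

/-- The restriction of an `L²` function to the band. -/
def cutoff (δ : ℝ) (F : L2) : L2 := ((Lp.memLp F).indicator (s := band δ) measurableSet_Icc).toLp _

theorem coeFn_cutoff (δ : ℝ) (F : L2) : cutoff δ F =ᵐ[volume] (band δ).indicator F :=
  ((Lp.memLp F).indicator (s := band δ) measurableSet_Icc).coeFn_toLp

theorem bandProj_eq (δ : ℝ) (f : L2) : bandProj δ f = 𝓕⁻ (cutoff δ (𝓕 f)) := rfl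

theorem bandCoeff_cutoff (δ : ℝ) (F : L2) (n : ℤ) : bandCoeff δ (cutoff δ F) n = bandCoeff δ F n := by
  refine bandCoeff_congr ?_ n
  filter_upwards [coeFn_cutoff δ F] with η h hη
  rw [h, Set.indicator_of_mem hη]

theorem shannonInv_bandProj (δ : ℝ) (f : L2) : shannonInv δ (bandProj δ f) = shannonInv δ f := by
  ext1 n
  rw [shannonInv_eq, shannonInv_eq, bandProj_eq, FourierTransform.fourier_fourierInv_eq,
    bandCoeff_cutoff]

theorem norm_sq_cutoff (δ : ℝ) (F : L2) : ‖cutoff δ F‖ ^ 2 = ∫ η in band δ, ‖F η‖ ^ 2 := by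
  rw [norm_sq_eq_integral, ← integral_indicator (measurableSet_band δ)]
  refine integral_congr_ae ?_
  filter_upwards [coeFn_cutoff δ F] with η h
  rw [h]
  by_cases hη : η ∈ band δ
  · rw [Set.indicator_of_mem hη, Set.indicator_of_mem (by exact hη)]
  · rw [Set.indicator_of_notMem hη, Set.indicator_of_notMem (by exact hη)]; simp

/-- Parseval gives both `‖A‖ = ‖B‖` and `Re ⟨A, B⟩ = ‖B‖²` for the two sides, so `‖A - B‖² = 0`. -/
theorem discreteFourier_bandCoeff (hδ : 0 < δ) (F : L2) :
    discreteFourier δ (bandCoeff δ F) = cutoff δ F := by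
  have hs := hasSum_norm_sq_bandCoeff hδ F
  have hw : Summable fun n => ‖bandCoeff δ F n‖ ^ 2 := by
    simpa [hδ.ne'] using hs.summable.mul_left δ⁻¹
  have n1 : ‖discreteFourier δ (bandCoeff δ F)‖ ^ 2 = ‖cutoff δ F‖ ^ 2 := by
    rw [norm_sq_discreteFourier hδ hw, norm_sq_cutoff, ← hs.tsum_eq, tsum_mul_left]
  have n2 : RCLike.re (inner ℂ (discreteFourier δ (bandCoeff δ F)) (cutoff δ F))
      = ‖cutoff δ F‖ ^ 2 := by
    have h := ((innerSL ℂ).flip (cutoff δ F)).hasSum (hasSum_latticeMode hδ hw)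
    have h' : HasSum (fun n => ((δ * ‖bandCoeff δ F n‖ ^ 2 : ℝ) : ℂ))
        (inner ℂ (discreteFourier δ (bandCoeff δ F)) (cutoff δ F)) := by
      refine h.congr_fun fun n => ?_
      change _ = inner ℂ (latticeMode δ n (bandCoeff δ F n)) (cutoff δ F)
      rw [inner_latticeMode, bandCoeff_cutoff, inner_self_eq_norm_sq_to_K]
      simp
    have h'' := (Complex.hasSum_ofReal.2 hs)
    rw [h'.unique h'', norm_sq_cutoff]
    simp
  rw [← sub_eq_zero, ← norm_eq_zero, ← sq_eq_zero_iff, @norm_sub_sq ℂ, n2, n1]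
  ring

theorem shannon_shannonInv (hδ : 0 < δ) (f : L2) : shannon δ (shannonInv δ f) = bandProj δ f := by
  rw [shannon, shannonInv_eq, discreteFourier_bandCoeff hδ, bandProj_eq]

theorem shannonInv_trans (δ : ℝ) (f : L2) (n : ℤ) :
    shannonInv δ (trans δ f) n = shannonInv δ f (n - 1) := by
  rw [shannonInv_eq, shannonInv_eq, bandCoeff, bandCoeff]
  refine integral_congr_ae (ae_restrict_of_ae ?_)
  filter_upwards [coeFn_fourier_trans δ f] with η h
  rw [h, smul_smul, phase, ← Complex.exp_add]
  congr 2
  push_cast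
  ring

theorem norm_bandProj_le (δ : ℝ) (f : L2) : ‖bandProj δ f‖ ≤ ‖f‖ := by
  have h1 : ‖bandProj δ f‖ = ‖cutoff δ (𝓕 f)‖ := (Lp.fourierTransformₗᵢ ℝ Spinor).symm.norm_map _
  rw [h1, ← Lp.norm_fourier_eq f]
  refine Lp.norm_le_norm_of_ae_le ?_
  filter_upwards [coeFn_cutoff δ (𝓕 f)] with η h
  rw [h]
  exact norm_indicator_le_norm_self _ _

theorem bandProj_sub (δ : ℝ) (f h : L2) : bandProj δ (f - h) = bandProj δ f - bandProj δ h := by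
  have e : (𝓕 (f - h) : L2) = 𝓕 f - 𝓕 h := (Lp.fourierTransformₗᵢ ℝ Spinor).map_sub f h
  have e2 : cutoff δ (𝓕 f - 𝓕 h) = cutoff δ (𝓕 f) - cutoff δ (𝓕 h) := by
    ext1
    filter_upwards [coeFn_cutoff δ (𝓕 f - 𝓕 h), coeFn_cutoff δ (𝓕 f), coeFn_cutoff δ (𝓕 h),
      Lp.coeFn_sub (𝓕 f : L2) (𝓕 h), Lp.coeFn_sub (cutoff δ (𝓕 f)) (cutoff δ (𝓕 h))]
      with η h1 h2 h3 h4 h5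
    rw [h1, h5, Pi.sub_apply, h2, h3]
    by_cases hη : η ∈ band δ
    · simp only [Set.indicator_of_mem hη, h4, Pi.sub_apply]
    · simp only [Set.indicator_of_notMem hη, sub_zero]
  rw [bandProj_eq, e, e2]
  exact (Lp.fourierTransformₗᵢ ℝ Spinor).symm.map_sub _ _

end NLQW
end

/-! ### Lattice functions as step functions, and convergence of sampling. -/

noncomputable section

namespace NLQW

/-! ### Step functions on the lattice -/

theorem measurable_floor_div (δ : ℝ) : Measurable fun x : ℝ => ⌊x / δ⌋ :=
  Int.measurable_floor.comp (measurable_id.div_const δ)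

/-- Each cell has length `δ`; this push-forward formula converts integrals of step functions into
`δ` times sums over the lattice. -/
theorem map_floor_div {δ : ℝ} (hδ : 0 < δ) :
    Measure.map (fun x : ℝ => ⌊x / δ⌋) volume = ENNReal.ofReal δ • Measure.count := by
  refine Measure.ext_of_singleton fun n => ?_
  rw [Measure.map_apply (measurable_floor_div δ) (measurableSet_singleton n)]
  have e : (fun x : ℝ => ⌊x / δ⌋) ⁻¹' {n} = Set.Ico (δ * n) (δ * n + δ) := by
    ext x
    simp only [Set.mem_preimage, Set.mem_singleton_iff, Int.floor_eq_iff, Set.mem_Ico]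
    rw [le_div_iff₀ hδ, div_lt_iff₀ hδ]
    constructor <;> rintro ⟨h1, h2⟩ <;> constructor <;> linarith
  rw [e, Real.volume_Ico]
  simp

variable {δ : ℝ} {w w' : ℤ → Spinor}

theorem memLp_step (hδ : 0 < δ) (hw : Summable fun n => ‖w n‖ ^ 2) :
    MemLp (fun x : ℝ => w ⌊x / δ⌋) 2 volume := by
  have hm : MemLp w 2 (Measure.map (fun x : ℝ => ⌊x / δ⌋) volume) := by
    rw [map_floor_div hδ]
    refine MemLp.smul_measure ?_ ENNReal.ofReal_ne_top
    rw [memLp_two_iff_integrable_sq_norm (measurable_of_countable w).aestronglyMeasurable,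
      integrable_count_iff]
    simpa using hw
  exact hm.comp_of_map (measurable_floor_div δ).aemeasurable

open Classical in
/-- The step function `x ↦ w ⌊x / δ⌋` as an element of `L²`. -/
def step (δ : ℝ) (w : ℤ → Spinor) : L2 :=
  if h : MemLp (fun x : ℝ => w ⌊x / δ⌋) 2 volume then h.toLp else 0

theorem coeFn_step (hδ : 0 < δ) (hw : Summable fun n => ‖w n‖ ^ 2) :
    step δ w =ᵐ[volume] fun x => w ⌊x / δ⌋ := by
  rw [step, dif_pos (memLp_step hδ hw)]
  exact MemLp.coeFn_toLp _

theorem norm_sq_step (hδ : 0 < δ) (hw : Summable fun n => ‖w n‖ ^ 2) :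
    ‖step δ w‖ ^ 2 = δ * ∑' n, ‖w n‖ ^ 2 := by
  have hi : Integrable (fun n => ‖w n‖ ^ 2) (ENNReal.ofReal δ • (Measure.count : Measure ℤ)) := by
    refine Integrable.smul_measure ?_ ENNReal.ofReal_ne_top
    rw [integrable_count_iff]
    simpa using hw
  calc ‖step δ w‖ ^ 2 = ∫ x, ‖w ⌊x / δ⌋‖ ^ 2 := by
        rw [norm_sq_eq_integral]
        refine integral_congr_ae ?_
        filter_upwards [coeFn_step hδ hw] with x hx
        rw [hx]
    _ = ∫ n, ‖w n‖ ^ 2 ∂(Measure.map (fun x : ℝ => ⌊x / δ⌋) volume) :=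
        (integral_map (measurable_floor_div δ).aemeasurable
          (measurable_of_countable fun n => ‖w n‖ ^ 2).aestronglyMeasurable).symm
    _ = _ := by
        rw [map_floor_div hδ, integral_countable hi, ← tsum_mul_left]
        refine tsum_congr fun n => ?_
        simp [Measure.real, hδ.le]

theorem step_sub (hδ : 0 < δ) (hw : Summable fun n => ‖w n‖ ^ 2)
    (hw' : Summable fun n => ‖w' n‖ ^ 2) :
    step δ w - step δ w' = step δ (fun n => w n - w' n) := by
  ext1
  filter_upwards [coeFn_step hδ hw, coeFn_step hδ hw', Lp.coeFn_sub (step δ w) (step δ w'),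
    coeFn_step hδ (summable_norm_sq_sub hw hw')] with x h1 h2 h3 h4
  rw [h3, Pi.sub_apply, h1, h2, h4]

/-- The bridge between the two pictures: both embeddings are `√δ` times an isometry of ℓ², so every
estimate can be made on step functions. -/
theorem norm_shannon_sub (hδ : 0 < δ) (hw : Summable fun n => ‖w n‖ ^ 2)
    (hw' : Summable fun n => ‖w' n‖ ^ 2) :
    ‖shannon δ w - shannon δ w'‖ = ‖step δ w - step δ w'‖ := by
  rw [← pow_left_inj₀ (norm_nonneg _) (norm_nonneg _) two_ne_zero, norm_sq_shannon_sub hδ hw hw',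
    step_sub hδ hw hw', norm_sq_step hδ (summable_norm_sq_sub hw hw')]

theorem summable_norm_sq_sub_one (hw : Summable fun n => ‖w n‖ ^ 2) :
    Summable fun n => ‖w (n - 1)‖ ^ 2 :=
  (Equiv.subRight (1 : ℤ)).summable_iff.2 hw

theorem summable_norm_sq_add_one (hw : Summable fun n => ‖w n‖ ^ 2) :
    Summable fun n => ‖w (n + 1)‖ ^ 2 :=
  (Equiv.addRight (1 : ℤ)).summable_iff.2 hw

theorem floor_sub_div (hδ : 0 < δ) (x : ℝ) : ⌊(x - δ) / δ⌋ = ⌊x / δ⌋ - 1 := by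
  rw [sub_div, div_self hδ.ne', Int.floor_sub_one]

theorem floor_add_div (hδ : 0 < δ) (x : ℝ) : ⌊(x + δ) / δ⌋ = ⌊x / δ⌋ + 1 := by
  rw [add_div, div_self hδ.ne', Int.floor_add_one]

theorem trans_step (hδ : 0 < δ) (hw : Summable fun n => ‖w n‖ ^ 2) :
    trans δ (step δ w) = step δ (fun n => w (n - 1)) := by
  ext1
  filter_upwards [coeFn_trans δ (step δ w), ae_comp_sub (coeFn_step hδ hw) δ,
    coeFn_step hδ (summable_norm_sq_sub_one hw)] with x h1 h2 h3
  rw [h1, h2, h3, floor_sub_div hδ]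

theorem summable_norm_sq_shift (hw : Summable fun n => ‖w n‖ ^ 2) :
    Summable fun n => ‖shift w n‖ ^ 2 := by
  refine Summable.of_nonneg_of_le (fun n => by positivity) (fun n => ?_)
    ((summable_norm_sq_sub_one hw).add (summable_norm_sq_add_one hw))
  rw [EuclideanSpace.norm_sq_eq, EuclideanSpace.norm_sq_eq, EuclideanSpace.norm_sq_eq]
  simp only [Fin.sum_univ_two, shift]
  simp only [Matrix.cons_val_zero, Matrix.cons_val_one]
  nlinarith [sq_nonneg ‖w (n - 1) 1‖, sq_nonneg ‖w (n + 1) 0‖]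

/-- The shift moves by exactly one cell, so the kinetic half of the splitting incurs no error. -/
theorem transport_step (hδ : 0 < δ) (hw : Summable fun n => ‖w n‖ ^ 2) :
    transport δ (step δ w) = step δ (shift w) := by
  ext1
  filter_upwards [coeFn_transport δ (step δ w), ae_comp_sub (coeFn_step hδ hw) δ,
    ae_comp_add (coeFn_step hδ hw) δ, coeFn_step hδ (summable_norm_sq_shift hw)] with x h1 h2 h3 h4
  rw [h1, h2, h3, h4, floor_sub_div hδ, floor_add_div hδ]
  rfl

/-! ### Sup bounds from a bound on the differences -/

/-- A discrete form of the embedding of `H¹` into Hölder functions of exponent 1/2: telescope over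
the `k` cells and apply Cauchy–Schwarz; `k δ` is the distance covered. -/
theorem norm_sub_le_of_norm_trans_step_sub_le (hδ : 0 < δ) (hw : Summable fun n => ‖w n‖ ^ 2)
    {M : ℝ} (hM : ‖trans δ (step δ w) - step δ w‖ ≤ M * δ) (n : ℤ) (k : ℕ) :
    ‖w (n + k) - w n‖ ≤ M * √(k * δ) := by
  have hM0 : 0 ≤ M := by
    have := (norm_nonneg _).trans hM
    exact nonneg_of_mul_nonneg_left this hδ
  have hs := summable_norm_sq_sub (summable_norm_sq_sub_one hw) hw
  have h1 : ∑' n, ‖w (n - 1) - w n‖ ^ 2 ≤ M ^ 2 * δ := by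
    have h2 : ‖trans δ (step δ w) - step δ w‖ ^ 2 ≤ (M * δ) ^ 2 := by gcongr
    rw [trans_step hδ hw, step_sub hδ (summable_norm_sq_sub_one hw) hw, norm_sq_step hδ hs] at h2
    refine le_of_mul_le_mul_left (h2.trans (le_of_eq ?_)) hδ
    ring
  have h2 : ∑ j ∈ Finset.range k, ‖w (n + (j + 1 : ℕ)) - w (n + (j : ℕ))‖ ^ 2 ≤ M ^ 2 * δ := by
    refine le_trans ?_ h1
    have hinj : Function.Injective fun j : ℕ => n + (j : ℤ) + 1 := fun i j hij => by
      simp only at hij; omega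
    have := hs.sum_le_tsum ((Finset.range k).map ⟨_, hinj⟩) (fun _ _ => by positivity)
    rw [Finset.sum_map] at this
    refine le_trans (le_of_eq (Finset.sum_congr rfl fun j _ => ?_)) this
    rw [norm_sub_rev]
    simp only [Function.Embedding.coeFn_mk, Nat.cast_add, Nat.cast_one, add_assoc]
    rw [← add_assoc n, add_sub_cancel_right]
  have h3 : ‖w (n + k) - w n‖ ≤ ∑ j ∈ Finset.range k, ‖w (n + (j + 1 : ℕ)) - w (n + (j : ℕ))‖ := by
    have := Finset.sum_range_sub (fun j : ℕ => w (n + j)) k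
    simp only [Nat.cast_zero, add_zero] at this
    rw [← this]
    exact norm_sum_le _ _
  refine h3.trans ?_
  refine abs_le_of_sq_le_sq' ?_ (by positivity) |>.2
  refine (sq_sum_le_card_mul_sum_sq).trans ?_
  rw [mul_pow, Real.sq_sqrt (by positivity), Finset.card_range]
  calc _ ≤ (k : ℝ) * (M ^ 2 * δ) := by gcongr
    _ = _ := by ring

/-- A lattice function with bounded difference quotients in `ℓ²` which is `L²`-close to a bounded
function is bounded. -/
theorem norm_apply_le_of_norm_step_sub_lt (hδ : 0 < δ) (hw : Summable fun n => ‖w n‖ ^ 2)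
    {M R c ℓ : ℝ} (hc : 0 ≤ c) (hℓ : 0 < ℓ)
    (hM : ‖trans δ (step δ w) - step δ w‖ ≤ M * δ) {f : L2} (hf : ∀ᵐ x, ‖f x‖ ≤ R)
    (hd : ‖step δ w - f‖ < c * √ℓ) (n : ℤ) : ‖w n‖ ≤ R + c + M * √ℓ := by
  by_contra! hlt
  have hM0 : 0 ≤ M := by
    have := (norm_nonneg _).trans hM
    exact nonneg_of_mul_nonneg_left this hδ
  -- If `‖w n‖` is too large, Hölder continuity keeps `w` at distance at least `c` from `f`
  -- throughout an interval of length `ℓ`, which forces an `L²` distance of at least `c √ℓ`.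
  have key : ∀ᵐ x, x ∈ Set.Ico (δ * n) (δ * n + ℓ) → c ≤ ‖(step δ w - f : L2) x‖ := by
    filter_upwards [hf, coeFn_step hδ hw, Lp.coeFn_sub (step δ w) f] with x h1 h2 h3 hx
    rw [h3, Pi.sub_apply, h2]
    have hfl : n ≤ ⌊x / δ⌋ := by
      rw [Int.le_floor, le_div_iff₀ hδ]; linarith [hx.1]
    obtain ⟨k, hk⟩ := Int.eq_ofNat_of_zero_le (sub_nonneg.2 hfl)
    have hk' : ⌊x / δ⌋ = n + k := by omega
    have hkδ : k * δ ≤ ℓ := by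
      have h4 : (⌊x / δ⌋ : ℝ) * δ ≤ x := by
        rw [← le_div_iff₀ hδ]; exact Int.floor_le _
      rw [hk'] at h4
      push_cast at h4
      linarith [hx.2]
    have h5 := norm_sub_le_of_norm_trans_step_sub_le hδ hw hM n k
    have h6 : M * √(k * δ) ≤ M * √ℓ := by gcongr
    rw [hk']
    have h7 : ‖w n‖ ≤ ‖w (n + k) - w n‖ + (‖w (n + k) - f x‖ + ‖f x‖) := by
      have a1 := norm_sub_norm_le (w n) (w (n + k))
      have a2 := norm_sub_norm_le (w (n + k)) (f x)
      rw [norm_sub_rev] at a1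
      linarith
    linarith
  have h1 : c ^ 2 * ℓ ≤ ‖step δ w - f‖ ^ 2 := by
    calc c ^ 2 * ℓ = ∫ _ in Set.Ico (δ * n) (δ * n + ℓ), c ^ 2 := by
          rw [setIntegral_const, Real.volume_real_Ico_of_le (by linarith)]
          simp [mul_comm]
      _ ≤ ∫ x in Set.Ico (δ * n) (δ * n + ℓ), ‖(step δ w - f : L2) x‖ ^ 2 := by
          refine setIntegral_mono_on_ae (by simp) (integrable_norm_sq _).integrableOn
            measurableSet_Ico ?_
          filter_upwards [key] with x h hx
          have := h hx
          gcongr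
      _ ≤ _ := by
          rw [norm_sq_eq_integral]
          exact setIntegral_le_integral (integrable_norm_sq _)
            (Eventually.of_forall fun _ => by positivity)
  have h2 : ‖step δ w - f‖ ^ 2 < (c * √ℓ) ^ 2 := by gcongr
  rw [mul_pow, Real.sq_sqrt hℓ.le] at h2
  linarith

/-! ### Sampling -/

/-- The step function of the Shannon samples. -/
def sample (δ : ℝ) (f : L2) : L2 := step δ (shannonInv δ f)

theorem norm_sample_le (hδ : 0 < δ) (f : L2) : ‖sample δ f‖ ≤ ‖f‖ := by
  refine abs_le_of_sq_le_sq' ?_ (norm_nonneg _) |>.2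
  rw [sample, norm_sq_step hδ (summable_norm_sq_shannonInv hδ f)]
  exact tsum_norm_sq_shannonInv_le hδ f

theorem sample_sub (hδ : 0 < δ) (f g : L2) : sample δ (f - g) = sample δ f - sample δ g := by
  rw [sample, sample, sample, step_sub hδ (summable_norm_sq_shannonInv hδ f)
    (summable_norm_sq_shannonInv hδ g)]
  congr 1
  ext1 n
  rw [shannonInv_sub]

theorem trans_sample (hδ : 0 < δ) (f : L2) : trans δ (sample δ f) = sample δ (trans δ f) := by
  rw [sample, trans_step hδ (summable_norm_sq_shannonInv hδ f), sample]
  congr 1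
  ext1 n
  rw [shannonInv_trans]

/-- Sampling is nonexpansive and commutes with translation by one cell, so the difference bound
passes from `f` to its samples. -/
theorem IsWeakDeriv.norm_trans_sample_sub_le (hδ : 0 < δ) {f g : L2} (h : IsWeakDeriv 1 f g) :
    ‖trans δ (sample δ f) - sample δ f‖ ≤ ‖g‖ * δ := by
  rw [trans_sample hδ, ← sample_sub hδ]
  refine (norm_sample_le hδ _).trans ?_
  simpa [abs_of_pos hδ] using h.norm_trans_sub_le δ

/-- A family of nonexpansive maps converging to the identity on a dense set converges to the
identity uniformly on compact sets. -/
theorem eventually_norm_sub_le_of_isCompact {A : ℝ → L2 → L2}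
    (hA : ∀ δ > 0, ∀ f g, ‖A δ f - A δ g‖ ≤ ‖f - g‖) {S : Set L2} (hS : Dense S)
    (hlim : ∀ f ∈ S, Tendsto (fun δ => A δ f) (𝓝[>] 0) (𝓝 f)) {K : Set L2} (hK : IsCompact K)
    {ε : ℝ} (hε : 0 < ε) : ∀ᶠ δ in 𝓝[>] 0, ∀ f ∈ K, ‖A δ f - f‖ ≤ ε := by
  have hε3 : 0 < ε / 3 := by positivity
  obtain ⟨t, ht⟩ := hK.elim_finite_subcover (fun s : S => Metric.ball (s : L2) (ε / 3))
    (fun _ => Metric.isOpen_ball) (fun f _ => by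
      obtain ⟨s, hs, hd⟩ := hS.exists_dist_lt f hε3
      exact Set.mem_iUnion.2 ⟨⟨s, hs⟩, hd⟩)
  have h : ∀ᶠ δ in 𝓝[>] (0 : ℝ), ∀ s ∈ t, ‖A δ s - s‖ ≤ ε / 3 := by
    rw [Filter.eventually_all_finset]
    intro s _
    filter_upwards [(hlim s s.2).eventually (Metric.closedBall_mem_nhds _ hε3)] with δ h
    rwa [dist_eq_norm] at h
  filter_upwards [h, self_mem_nhdsWithin] with δ h1 hδ f hf
  obtain ⟨s, hs, hd⟩ := Set.mem_iUnion₂.1 (ht hf)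
  rw [mem_ball_iff_norm] at hd
  have e : A δ f - f = (A δ f - A δ s) + (A δ s - s) - (f - s) := by abel
  rw [e]
  have h2 := norm_sub_le ((A δ f - A δ s) + (A δ s - s)) (f - s)
  have h3 := norm_add_le (A δ f - A δ s) (A δ s - s)
  have h4 := hA δ hδ f s
  have h5 := h1 s hs
  linarith

/-- The `L²` functions with smooth compactly supported Fourier transform. -/
def bandLimited : Set L2 :=
  {f | ∃ ψ : 𝓢(ℝ, Spinor), HasCompactSupport ψ ∧ (𝓕 f : L2) = ψ.toLp 2}

theorem dense_bandLimited : Dense bandLimited := by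
  have hd := Lp.dense_hasCompactSupport_contDiff (E := ℝ) (F := Spinor) (μ := volume) (p := 2)
    (by simp)
  have := (Lp.fourierTransformₗᵢ ℝ Spinor).symm.surjective.denseRange.dense_image
    (Lp.fourierTransformₗᵢ ℝ Spinor).symm.continuous hd
  refine this.mono ?_
  rintro _ ⟨F, ⟨ψ, h1, h2, h3⟩, rfl⟩
  refine ⟨h2.toSchwartzMap h3, h2, ?_⟩
  have e : (𝓕 ((Lp.fourierTransformₗᵢ ℝ Spinor).symm F) : L2) = F :=
    (Lp.fourierTransformₗᵢ ℝ Spinor).apply_symm_apply F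
  rw [e]
  ext1
  filter_upwards [h1, (h2.toSchwartzMap h3).coeFn_toLp 2 volume] with x h4 h5
  rw [h4, h5]
  rfl

theorem eventually_subset_band {φ : ℝ → Spinor} (h : HasCompactSupport φ) :
    ∀ᶠ δ : ℝ in 𝓝[>] 0, ∀ η, η ∉ band δ → φ η = 0 := by
  obtain ⟨r, hr⟩ := h.isBounded.subset_closedBall 0
  have hT : Tendsto (fun δ : ℝ => 1 / (2 * δ)) (𝓝[>] 0) atTop := by
    have := tendsto_inv_nhdsGT_zero (𝕜 := ℝ)
    refine (this.const_mul_atTop (by norm_num : (0 : ℝ) < 1 / 2)).congr fun δ => ?_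
    rw [one_div_mul_eq_div, one_div, mul_inv]; ring
  filter_upwards [hT.eventually_ge_atTop r] with δ hδ η hη
  by_contra hne
  have := hr (subset_tsupport φ hne)
  rw [mem_closedBall_zero_iff, Real.norm_eq_abs, abs_le] at this
  exact hη ⟨by linarith [this.1], by linarith [this.2]⟩

theorem tendsto_bandProj {f : L2} (hf : f ∈ bandLimited) :
    Tendsto (fun δ => bandProj δ f) (𝓝[>] 0) (𝓝 f) := by
  obtain ⟨ψ, h1, h2⟩ := hf
  refine tendsto_const_nhds.congr' ?_
  filter_upwards [eventually_subset_band h1] with δ hδ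
  have e : cutoff δ (𝓕 f) = 𝓕 f := by
    rw [h2]
    ext1
    filter_upwards [coeFn_cutoff δ (ψ.toLp 2), ψ.coeFn_toLp 2 volume] with η h3 h4
    rw [h3]
    by_cases hη : η ∈ band δ
    · rw [Set.indicator_of_mem hη]
    · rw [Set.indicator_of_notMem hη, h4, hδ η hη]
  rw [bandProj_eq, e, FourierTransform.fourierInv_fourier_eq]

/-- Once the band contains the Fourier support, the Shannon samples are true point values; on this
dense class, convergence of sampling reduces to uniform smoothness. -/
theorem shannonInv_of_bandLimited {f : L2} {ψ : 𝓢(ℝ, Spinor)} (h2 : (𝓕 f : L2) = ψ.toLp 2)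
    (hδ : ∀ η, η ∉ band δ → ψ η = 0) (n : ℤ) : shannonInv δ f n = (𝓕⁻ ψ) (δ * n) := by
  rw [shannonInv_eq, bandCoeff, h2, SchwartzMap.fourierInv_coe, Real.fourierInv_eq']
  rw [← setIntegral_eq_integral_of_forall_compl_eq_zero (s := band δ)
    (f := fun v : ℝ => Complex.exp _ • ψ v)]
  · refine setIntegral_congr_ae (measurableSet_band δ) ?_
    filter_upwards [ψ.coeFn_toLp 2 volume] with η h _
    rw [h]
    congr 2
    simp
    ring
  · intro η hη
    rw [hδ η hη, smul_zero]

theorem exists_norm_schwartz_sub_le (φ : 𝓢(ℝ, Spinor)) :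
    ∃ C, ∀ x y : ℝ, y ≤ x → x - y ≤ 1 → ‖φ y - φ x‖ ≤ (x - y) * (C * (1 + x ^ 2)⁻¹) := by
  obtain ⟨C₀, -, h0⟩ := φ.decay 0 1
  obtain ⟨C₂, -, h2⟩ := φ.decay 2 1
  refine ⟨3 * (C₀ + C₂), fun x y hyx hxy => ?_⟩
  have hb : ∀ z ∈ Set.Icc y x, ‖deriv φ z‖ ≤ 3 * (C₀ + C₂) * (1 + x ^ 2)⁻¹ := by
    intro z hz
    have a0 := h0 z
    have a2 := h2 z
    rw [norm_iteratedFDeriv_eq_norm_iteratedDeriv, iteratedDeriv_one] at a0 a2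
    rw [← div_eq_mul_inv, le_div_iff₀ (by positivity)]
    rw [Real.norm_eq_abs, sq_abs] at a2
    rw [pow_zero, one_mul] at a0
    -- As `|x - z| ≤ 1`, the decay at an intermediate point is comparable with that at `x`. The
    -- bound is `δ` times an `L²` function independent of `δ`.
    have hq : 1 + x ^ 2 ≤ 3 * (1 + z ^ 2) := by
      nlinarith [sq_nonneg (2 * z - x), hz.1, hz.2, mul_nonneg (sub_nonneg.2 hz.2)
        (by linarith [hz.1] : 0 ≤ 1 - (x - z))]
    calc ‖deriv φ z‖ * (1 + x ^ 2) ≤ ‖deriv φ z‖ * (3 * (1 + z ^ 2)) := by gcongr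
      _ ≤ _ := by linarith
  have := Convex.norm_image_sub_le_of_norm_deriv_le (𝕜 := ℝ) (f := φ) (s := Set.Icc y x)
    (fun z _ => φ.differentiable.differentiableAt) hb (convex_Icc y x)
    (Set.right_mem_Icc.2 hyx) (Set.left_mem_Icc.2 hyx)
  rw [Real.norm_eq_abs, abs_sub_comm, abs_of_nonneg (sub_nonneg.2 hyx)] at this
  linarith

theorem memLp_inv_one_add_sq (C : ℝ) : MemLp (fun x : ℝ => C * (1 + x ^ 2)⁻¹) 2 volume := by
  refine MemLp.const_mul ?_ C
  have hc : Continuous fun x : ℝ => (1 + x ^ 2)⁻¹ :=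
    Continuous.inv₀ (by fun_prop) fun x => by positivity
  rw [memLp_two_iff_integrable_sq_norm hc.aestronglyMeasurable]
  refine integrable_inv_one_add_sq.mono' (by fun_prop) (Eventually.of_forall fun x => ?_)
  have h1 : (1 + x ^ 2)⁻¹ ≤ 1 := inv_le_one_of_one_le₀ (by nlinarith [sq_nonneg x])
  have h0 : 0 ≤ (1 + x ^ 2)⁻¹ := by positivity
  rw [Real.norm_of_nonneg h0, Real.norm_of_nonneg (by positivity), sq]
  exact mul_le_of_le_one_left h0 h1

theorem tendsto_sample {f : L2} (hf : f ∈ bandLimited) :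
    Tendsto (fun δ => sample δ f) (𝓝[>] 0) (𝓝 f) := by
  obtain ⟨ψ, h1, h2⟩ := hf
  have hfφ : f = (𝓕⁻ ψ).toLp 2 := by
    rw [← SchwartzMap.toLp_fourierInv_eq, ← h2, FourierTransform.fourierInv_fourier_eq]
  obtain ⟨C, hC⟩ := exists_norm_schwartz_sub_le (𝓕⁻ ψ)
  rw [tendsto_iff_norm_sub_tendsto_zero]
  have hlin : Tendsto (fun δ : ℝ => δ * ‖(memLp_inv_one_add_sq C).toLp‖) (𝓝[>] 0) (𝓝 0) := by
    have : Tendsto (fun δ : ℝ => δ * ‖(memLp_inv_one_add_sq C).toLp‖) (𝓝 0)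
        (𝓝 (0 * ‖(memLp_inv_one_add_sq C).toLp‖)) := Continuous.tendsto (by fun_prop) 0
    rw [zero_mul] at this
    exact this.mono_left nhdsWithin_le_nhds
  refine squeeze_zero' (Eventually.of_forall fun _ => norm_nonneg _) ?_ hlin
  filter_upwards [eventually_subset_band h1, self_mem_nhdsWithin,
    nhdsWithin_le_nhds (gt_mem_nhds (zero_lt_one' ℝ))] with δ hband hδ hδ1
  have hδ : 0 < δ := hδ
  refine Lp.norm_le_mul_norm_of_ae_le_mul ?_
  have hst := coeFn_step hδ (summable_norm_sq_shannonInv hδ f)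
  have hsub := Lp.coeFn_sub (sample δ f) f
  have hf' : f =ᵐ[volume] (𝓕⁻ ψ : 𝓢(ℝ, Spinor)) := by
    rw [hfφ]; exact (𝓕⁻ ψ).coeFn_toLp 2 volume
  filter_upwards [hst, hsub, hf', (memLp_inv_one_add_sq C).coeFn_toLp] with x a1 a2 a3 a4
  rw [a2, Pi.sub_apply, sample, a1, a3, a4, shannonInv_of_bandLimited h2 hband]
  have b1 : δ * ⌊x / δ⌋ ≤ x := by
    rw [mul_comm, ← le_div_iff₀ hδ]; exact Int.floor_le _
  have b2 : x - δ * ⌊x / δ⌋ ≤ δ := by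
    have := (div_lt_iff₀ hδ).1 (Int.lt_floor_add_one (x / δ))
    linarith
  refine (hC x _ b1 (b2.trans hδ1.le)).trans ?_
  calc _ ≤ (x - δ * ⌊x / δ⌋) * ‖C * (1 + x ^ 2)⁻¹‖ := by
        gcongr
        exact Real.le_norm_self _
    _ ≤ _ := by gcongr

theorem eventually_norm_sample_sub_le {K : Set L2} (hK : IsCompact K) {ε : ℝ} (hε : 0 < ε) :
    ∀ᶠ δ in 𝓝[>] 0, ∀ f ∈ K, ‖sample δ f - f‖ ≤ ε :=
  eventually_norm_sub_le_of_isCompact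
    (fun δ hδ f g => by rw [← sample_sub hδ]; exact norm_sample_le hδ _)
    dense_bandLimited (fun _ => tendsto_sample) hK hε

theorem eventually_norm_bandProj_sub_le {K : Set L2} (hK : IsCompact K) {ε : ℝ} (hε : 0 < ε) :
    ∀ᶠ δ in 𝓝[>] 0, ∀ f ∈ K, ‖bandProj δ f - f‖ ≤ ε :=
  eventually_norm_sub_le_of_isCompact
    (fun δ _ f g => by rw [← bandProj_sub]; exact norm_bandProj_le δ _)
    dense_bandLimited (fun _ => tendsto_bandProj) hK hε

/-- The Sobolev embedding `H¹ ⊆ L^∞`. -/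
theorem IsWeakDeriv.ae_norm_le {f g : L2} (h : IsWeakDeriv 1 f g) :
    ∀ᵐ x, ‖f x‖ ≤ ‖f‖ + 1 + ‖g‖ := by
  have hb : ∀ δ > 0, ∀ᵐ x, ‖sample δ f x‖ ≤ ‖f‖ + 1 + ‖g‖ := by
    intro δ hδ
    have hs := summable_norm_sq_shannonInv hδ f
    have hz : ∀ᵐ x, ‖(0 : L2) x‖ ≤ 0 := by
      filter_upwards [Lp.coeFn_zero Spinor 2 (volume : Measure ℝ)] with x hx
      rw [hx]; simp
    -- The samples are compared with the zero function, on intervals of length `ℓ = 1`; the extra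
    -- `1` in the bound makes this inequality strict.
    have hd : ‖step δ (shannonInv δ f) - 0‖ < (‖f‖ + 1) * √1 := by
      rw [sub_zero, Real.sqrt_one, mul_one]
      exact (norm_sample_le hδ f).trans_lt (lt_add_one _)
    have := norm_apply_le_of_norm_step_sub_lt hδ hs (by positivity) one_pos
      (h.norm_trans_sample_sub_le hδ) hz hd
    filter_upwards [coeFn_step hδ hs] with x hx
    rw [sample, hx]
    simpa using this ⌊x / δ⌋
  have hlim : Tendsto (fun δ => sample δ f) (𝓝[>] 0) (𝓝 f) := by
    rw [Metric.tendsto_nhds]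
    intro ε hε
    filter_upwards [eventually_norm_sample_sub_le (isCompact_singleton (x := f)) (half_pos hε)]
      with δ hδ
    rw [dist_eq_norm]
    linarith [hδ f rfl]
  have hseq : Tendsto (fun k : ℕ => 1 / ((k : ℝ) + 1)) atTop (𝓝[>] 0) :=
    tendsto_nhdsWithin_iff.2 ⟨tendsto_one_div_add_atTop_nhds_zero_nat,
      Eventually.of_forall fun k => by simp only [Set.mem_Ioi]; positivity⟩
  -- Convergence in `L²` gives almost everywhere convergence along a subsequence, through which the
  -- uniform bound passes to `f`.
  obtain ⟨ns, -, hae⟩ :=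
    (tendstoInMeasure_of_tendsto_Lp (hlim.comp hseq)).exists_seq_tendsto_ae
  have hall : ∀ᵐ x, ∀ k : ℕ, ‖sample (1 / ((k : ℝ) + 1)) f x‖ ≤ ‖f‖ + 1 + ‖g‖ :=
    ae_all_iff.2 fun k => hb _ (by positivity)
  filter_upwards [hae, hall] with x h1 h2
  exact le_of_tendsto h1.norm (Eventually.of_forall fun k => h2 (ns k))

end NLQW
end

/-! ### Stability and consistency of one time step in `L²`. -/

noncomputable section

namespace NLQW

/-! ### Superposition operators on `L²` -/

open Classical in
/-- The superposition operator `f ↦ φ(·, f(·))` on `L²`. -/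
def superposition (φ : ℝ → Spinor → Spinor) (f : L2) : L2 :=
  if h : MemLp (fun x => φ x (f x)) 2 volume then h.toLp else 0

/-- Measurable functions `φ(x, v)` of linear growth in `v`. -/
def LinearGrowth (φ : ℝ → Spinor → Spinor) : Prop :=
  Measurable (Function.uncurry φ) ∧ ∃ B, ∀ x v, ‖φ x v‖ ≤ B * ‖v‖

theorem LinearGrowth.coeFn {φ : ℝ → Spinor → Spinor} (h : LinearGrowth φ) (f : L2) :
    superposition φ f =ᵐ[volume] fun x => φ x (f x) := by
  have hm : MemLp (fun x => φ x (f x)) 2 volume := by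
    obtain ⟨B, hB⟩ := h.2
    refine (Lp.memLp f).of_le_mul (c := B) ?_ (Eventually.of_forall fun x => hB x (f x))
    exact (h.1.comp_aemeasurable (aemeasurable_id.prodMk
      (Lp.aestronglyMeasurable f).aemeasurable)).aestronglyMeasurable
  rw [superposition, dif_pos hm]
  exact hm.coeFn_toLp

theorem LinearGrowth.norm_sub_le {φ : ℝ → Spinor → Spinor} (h : LinearGrowth φ) {B : ℝ}
    (hB : ∀ x v w, ‖φ x v - φ x w‖ ≤ B * ‖v - w‖) (f g : L2) :
    ‖superposition φ f - superposition φ g‖ ≤ B * ‖f - g‖ := by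
  refine Lp.norm_le_mul_norm_of_ae_le_mul ?_
  filter_upwards [h.coeFn f, h.coeFn g, Lp.coeFn_sub (superposition φ f) (superposition φ g),
    Lp.coeFn_sub f g] with x h1 h2 h3 h4
  rw [h3, h4, Pi.sub_apply, Pi.sub_apply, h1, h2]
  exact hB x _ _

variable {a : ℝ → Coeff} {γ : Mat2} {G : Spinor → ℝ} {K : ℝ}

theorem TameCoefficients.continuous_op (h : TameCoefficients a G K) :
    Continuous fun y => op (pauliDot (a y)) := by
  obtain ⟨P, hP, hpd⟩ := norm_op_pauliDot_le
  refine (LipschitzWith.of_dist_le_mul (K := (P * K).toNNReal) fun x y => ?_).continuous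
  rw [dist_eq_norm, ← op_sub, ← pauliDot_sub,
    Real.coe_toNNReal _ (mul_nonneg hP h.nonneg), Real.dist_eq]
  refine (hpd _).trans ?_
  rw [mul_assoc]
  gcongr
  exact h.lipschitz x y

theorem TameCoefficients.linearGrowth_potential (h : TameCoefficients a G K) (hG : Continuous G)
    (γ : Mat2) : LinearGrowth (potential a γ G) := by
  obtain ⟨B, -, hB, -, -⟩ := h.potential_lipschitz γ
  refine ⟨Continuous.measurable ?_, B, hB⟩
  have h1 := h.continuous_op.comp (continuous_fst (X := ℝ) (Y := Spinor))
  have h2 := h1.clm_apply continuous_snd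
  have h3 : Continuous fun p : ℝ × Spinor => (G p.2 : ℂ) • op γ p.2 := by fun_prop
  exact h2.add h3

theorem continuous_exp_clm :
    Continuous (NormedSpace.exp : (Spinor →L[ℂ] Spinor) → (Spinor →L[ℂ] Spinor)) := by
  let _ : NormedAlgebra ℚ (Spinor →L[ℂ] Spinor) := NormedAlgebra.restrictScalars ℚ ℂ _
  exact NormedSpace.exp_continuous

theorem continuous_exp_smul {X : Type*} [TopologicalSpace X] {c : X → ℂ}
    {A : X → Spinor →L[ℂ] Spinor} (hc : Continuous c) (hA : Continuous A) :
    Continuous fun x => NormedSpace.exp (c x • A x) :=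
  continuous_exp_clm.comp (hc.smul hA)

/-- The local evolution of the walk on step functions. -/
def stepCoin (a : ℝ → Coeff) (γ : Mat2) (G : Spinor → ℝ) (δ x : ℝ) (v : Spinor) : Spinor :=
  coinMap a γ G δ (δ * ⌊x / δ⌋) v

theorem TameCoefficients.continuous_coinMap (h : TameCoefficients a G K) (hG : Continuous G)
    (γ : Mat2) (δ : ℝ) : Continuous fun p : ℝ × Spinor => coinMap a γ G δ p.1 p.2 := by
  have h1 : Continuous fun p : ℝ × Spinor => op (pauliDot (a p.1)) :=
    h.continuous_op.comp continuous_fst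
  have h2 : Continuous fun p : ℝ × Spinor => -(Complex.I * ((δ * G p.2 : ℝ) : ℂ)) := by fun_prop
  have h3 := (continuous_exp_smul continuous_const (c := fun _ => -(Complex.I * (δ : ℂ))) h1)
  have h4 := continuous_exp_smul h2 (continuous_const (y := op γ))
  have h5 := h3.clm_apply (h4.clm_apply continuous_snd)
  refine h5.congr fun p => ?_
  rw [coinMap_eq, op_smul, op_smul]

theorem TameCoefficients.linearGrowth_stepCoin (h : TameCoefficients a G K) (hG : Continuous G)
    (hγ : γ.IsHermitian) (δ : ℝ) : LinearGrowth (stepCoin a γ G δ) := by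
  refine ⟨?_, 1, fun x v => by rw [stepCoin, norm_coinMap hγ, one_mul]⟩
  have hm : Measurable fun p : ℝ × Spinor => ((δ * ⌊p.1 / δ⌋ : ℝ), p.2) := by
    refine Measurable.prodMk ?_ measurable_snd
    refine Measurable.const_mul ?_ δ
    exact (measurable_of_countable fun n : ℤ => (n : ℝ)).comp
      ((measurable_floor_div δ).comp measurable_fst)
  have e : Function.uncurry (stepCoin a γ G δ) = (fun p : ℝ × Spinor => coinMap a γ G δ p.1 p.2) ∘
      fun p : ℝ × Spinor => ((δ * ⌊p.1 / δ⌋ : ℝ), p.2) := by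
    funext p
    simp only [Function.uncurry, stepCoin, Function.comp_apply]
  rw [e]
  exact (h.continuous_coinMap hG γ δ).measurable.comp hm

/-- One step of the walk on `L²`, before the shift: Lipschitz bound, quasi-commutation with the
translation by a lattice step, and consistency with the Euler step. -/
theorem TameCoefficients.exists_stepCoin_bounds (h : TameCoefficients a G K) (hG : Continuous G)
    (hγ : γ.IsHermitian) :
    ∃ B, 0 ≤ B ∧ ∀ᶠ δ : ℝ in 𝓝[>] 0,
      (∀ f g : L2, ‖superposition (stepCoin a γ G δ) f - superposition (stepCoin a γ G δ) g‖
        ≤ (1 + B * δ) * ‖f - g‖) ∧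
      (∀ f : L2, ‖trans δ (superposition (stepCoin a γ G δ) f)
        - superposition (stepCoin a γ G δ) f‖
        ≤ (1 + B * δ) * ‖trans δ f - f‖ + B * δ * δ * ‖f‖) := by
  obtain ⟨B, hB, hev⟩ := h.exists_coinMap_lipschitz hγ
  refine ⟨B, hB, ?_⟩
  filter_upwards [hev, self_mem_nhdsWithin] with δ ⟨h1, h2⟩ hδ
  have hδ : 0 < δ := hδ
  have hg := h.linearGrowth_stepCoin hG hγ δ
  refine ⟨fun f g => hg.norm_sub_le (fun x v w => h1 _ v w) f g, fun f => ?_⟩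
  refine (norm_le_add_mul_of_ae_le (by positivity) (by positivity) (g := trans δ f - f)
    (h := f) ?_)
  filter_upwards [hg.coeFn f, ae_comp_sub (hg.coeFn f) δ,
    coeFn_trans δ (superposition (stepCoin a γ G δ) f),
    Lp.coeFn_sub (trans δ (superposition (stepCoin a γ G δ) f))
      (superposition (stepCoin a γ G δ) f), Lp.coeFn_sub (trans δ f) f, coeFn_trans δ f]
    with x b1 b2 b3 b4 b5 b6
  rw [b4, Pi.sub_apply, b3, b2, b1, b5, Pi.sub_apply, b6, stepCoin, stepCoin, floor_sub_div hδ]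
  -- First the spinor changes, at a fixed lattice point, then the lattice point moves by `δ`. The
  -- latter costs `Bδ · δ`, small enough to be summed over `T/δ` steps after division by `δ`.
  have e : coinMap a γ G δ (δ * (⌊x / δ⌋ - 1 : ℤ)) (f (x - δ)) - coinMap a γ G δ (δ * ⌊x / δ⌋) (f x)
      = (coinMap a γ G δ (δ * (⌊x / δ⌋ - 1 : ℤ)) (f (x - δ))
          - coinMap a γ G δ (δ * (⌊x / δ⌋ - 1 : ℤ)) (f x))
        + (coinMap a γ G δ (δ * (⌊x / δ⌋ - 1 : ℤ)) (f x) - coinMap a γ G δ (δ * ⌊x / δ⌋) (f x)) := by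
    abel
  rw [e]
  refine (norm_add_le _ _).trans (add_le_add (h1 _ _ _) ((h2 _ _ _).trans (le_of_eq ?_)))
  congr 2
  push_cast
  rw [mul_sub, mul_one, sub_sub_cancel_left, abs_neg, abs_of_pos hδ]

/-- The coin reads its coefficients at the left end of the cell and the equation reads them at `x`;
the mismatch is at most `δ · Bδ`, absorbed together with the pointwise Euler error. -/
theorem TameCoefficients.eventually_stepCoin_euler (h : TameCoefficients a G K)
    (hG : Continuous G) (hγ : γ.IsHermitian) {ε : ℝ} (hε : 0 < ε) :
    ∀ᶠ δ : ℝ in 𝓝[>] 0, ∀ f : L2, ‖superposition (stepCoin a γ G δ) f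
      - (f - (δ * Complex.I : ℂ) • superposition (potential a γ G) f)‖ ≤ ε * δ * ‖f‖ := by
  obtain ⟨B, hB, -, -, hB3⟩ := h.potential_lipschitz γ
  filter_upwards [h.eventually_coinMap_euler hγ (half_pos hε), eventually_small B (half_pos hε),
    self_mem_nhdsWithin] with δ h1 h2 hδ f
  have hδ : 0 < δ := hδ
  rw [abs_of_pos hδ] at h2
  have hg := h.linearGrowth_stepCoin hG hγ δ
  have hp := h.linearGrowth_potential hG γ
  refine Lp.norm_le_mul_norm_of_ae_le_mul ?_
  filter_upwards [hg.coeFn f, hp.coeFn f,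
    Lp.coeFn_sub (superposition (stepCoin a γ G δ) f)
      (f - (δ * Complex.I : ℂ) • superposition (potential a γ G) f),
    Lp.coeFn_sub f ((δ * Complex.I : ℂ) • superposition (potential a γ G) f),
    Lp.coeFn_smul (δ * Complex.I : ℂ) (superposition (potential a γ G) f)] with x b1 b2 b3 b4 b5
  rw [b3, Pi.sub_apply, b4, Pi.sub_apply, b5, Pi.smul_apply, b1, b2, stepCoin]
  have e : coinMap a γ G δ (δ * ⌊x / δ⌋) (f x)
        - (f x - (δ * Complex.I : ℂ) • potential a γ G x (f x))
      = (coinMap a γ G δ (δ * ⌊x / δ⌋) (f x)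
        - (f x - (δ * Complex.I : ℂ) • potential a γ G (δ * ⌊x / δ⌋) (f x)))
        - (δ * Complex.I : ℂ) • (potential a γ G (δ * ⌊x / δ⌋) (f x) - potential a γ G x (f x)) := by
    rw [smul_sub]; abel
  rw [e]
  have c1 : δ * ⌊x / δ⌋ ≤ x := by
    rw [mul_comm, ← le_div_iff₀ hδ]; exact Int.floor_le _
  have c2 : x - δ * ⌊x / δ⌋ ≤ δ := by
    have := (div_lt_iff₀ hδ).1 (Int.lt_floor_add_one (x / δ))
    linarith
  have c3 : |δ * ⌊x / δ⌋ - x| ≤ δ := by rw [abs_le]; constructor <;> linarith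
  have n2 : ‖(δ * Complex.I : ℂ) • (potential a γ G (δ * ⌊x / δ⌋) (f x)
      - potential a γ G x (f x))‖ ≤ ε / 2 * δ * ‖f x‖ := by
    rw [norm_smul]
    have : ‖(δ * Complex.I : ℂ)‖ = δ := by simp [hδ.le]
    rw [this]
    calc _ ≤ δ * (B * |δ * ⌊x / δ⌋ - x| * ‖f x‖) := by gcongr; exact hB3 _ _ _
      _ ≤ δ * (B * δ * ‖f x‖) := by gcongr
      _ = δ * B * δ * ‖f x‖ := by ring
      _ ≤ _ := by gcongr
  refine (norm_sub_le _ _).trans ((add_le_add (h1 _ _) n2).trans (le_of_eq ?_))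
  ring

/-! ### Duhamel's formula to first order -/

/-- A product rule without norm differentiability of the flow: the flow is differentiated on the
fixed vector `v r`, which has a weak derivative, while the increment `v q - v r` is handled by joint
continuity of the flow. -/
theorem hasDerivWithinAt_transport_neg {v : ℝ → L2} {v' g : L2} {s : Set ℝ} {r : ℝ}
    (hv : HasDerivWithinAt v v' s r) (hg : IsWeakDeriv 1 (v r) g) :
    HasDerivWithinAt (fun q => transport (-q) (v q)) (transport (-r) (v' + sigmaThree g)) s r := by
  have h1 := (hg.hasDerivAt_transport_neg r).hasDerivWithinAt (s := s)
  have h2 : HasDerivWithinAt (fun q => transport (-q) (v q - v r)) (transport (-r) v') s r := by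
    rw [hasDerivWithinAt_iff_tendsto_slope] at hv ⊢
    have hq : Tendsto (fun q : ℝ => -q) (𝓝[s \ {r}] r) (𝓝 (-r)) :=
      (continuous_neg.tendsto r).mono_left nhdsWithin_le_nhds
    have := (continuous_transport.tendsto (-r, v')).comp (hq.prodMk_nhds hv)
    refine this.congr fun q => ?_
    simp only [Function.comp_apply, slope, vsub_eq_sub, sub_self, map_zero, sub_zero]
    rw [real_smul_eq, real_smul_eq, map_smul]
  have h3 := h2.add h1
  rw [map_add]
  refine h3.congr (fun q _ => ?_) ?_ <;> simp

/-- A function with values in `H¹` whose time derivative is `-σ₃ ∂ₓ u - i p`, with `p` continuous,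
follows the free evolution with the source `-i p` up to `o(δ)`. -/
theorem eventually_norm_transport_sub_le {T : ℝ} {u p u' : ℝ → L2}
    (hp : ContinuousOn p (Set.Icc 0 T))
    (hu' : ∀ t ∈ Set.Icc 0 T, IsWeakDeriv 1 (u t) (u' t))
    (hu : ∀ t ∈ Set.Icc 0 T,
      HasDerivWithinAt u (-sigmaThree (u' t) - Complex.I • p t) (Set.Icc 0 T) t)
    {ε : ℝ} (hε : 0 < ε) :
    ∀ᶠ δ : ℝ in 𝓝[>] 0, ∀ t, 0 ≤ t → t + δ ≤ T →
      ‖transport (-δ) (u (t + δ)) - (u t - (δ * Complex.I : ℂ) • p t)‖ ≤ ε * δ := by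
  -- Uniform continuity on this compact rectangle is what makes the final estimate uniform in `t`.
  have hcont : ContinuousOn (fun q : ℝ × ℝ => transport (-q.1) (p q.2))
      (Set.Icc 0 1 ×ˢ Set.Icc 0 T) := by
    refine continuous_transport.comp_continuousOn (f := fun q : ℝ × ℝ => (-q.1, p q.2)) ?_
    refine (continuous_fst.neg.continuousOn).prodMk ?_
    exact hp.comp continuous_snd.continuousOn fun q hq => hq.2
  have huc := (isCompact_Icc.prod isCompact_Icc).uniformContinuousOn_of_continuous hcont
  rw [Metric.uniformContinuousOn_iff] at huc
  obtain ⟨η, hη, huc⟩ := huc ε hε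
  filter_upwards [self_mem_nhdsWithin, nhdsWithin_le_nhds (gt_mem_nhds hη),
    nhdsWithin_le_nhds (gt_mem_nhds (zero_lt_one' ℝ))] with δ hδ hδη hδ1 t ht htT
  have hδ : 0 < δ := hδ
  have hmem : ∀ r ∈ Set.Icc 0 δ, t + r ∈ Set.Icc 0 T := fun r hr =>
    ⟨by linarith [hr.1], by linarith [hr.2]⟩
  -- With the source frozen at time `t` compensated by a linear term, the derivative is a difference
  -- of nearby values of `transport (-r) (p ·)`, and the mean value inequality yields `ε δ`.
  have hd : ∀ r ∈ Set.Icc 0 δ, HasDerivWithinAt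
      (fun r => transport (-r) (u (t + r)) + (r : ℝ) • (Complex.I • p t))
      (transport (-r) (-(Complex.I • p (t + r))) + (1 : ℝ) • (Complex.I • p t)) (Set.Icc 0 δ) r := by
    intro r hr
    have h1 : HasDerivWithinAt (fun r => u (t + r))
        (-sigmaThree (u' (t + r)) - Complex.I • p (t + r)) (Set.Icc 0 δ) r := by
      have := (hu (t + r) (hmem r hr)).scomp r
        ((hasDerivAt_id r).const_add t).hasDerivWithinAt (s := Set.Icc 0 δ)
        (fun q hq => hmem q hq)
      rw [one_smul] at this
      exact this
    have h2 := hasDerivWithinAt_transport_neg h1 (hu' (t + r) (hmem r hr))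
    have h3 := ((hasDerivAt_id r).smul_const (Complex.I • p t)).hasDerivWithinAt
      (s := Set.Icc 0 δ)
    refine (h2.add h3).congr_deriv ?_
    congr 2
    abel
  have hb : ∀ r ∈ Set.Ico 0 δ,
      ‖transport (-r) (-(Complex.I • p (t + r))) + (1 : ℝ) • (Complex.I • p t)‖ ≤ ε := by
    intro r hr
    have h0T : t ∈ Set.Icc 0 T := ⟨ht, by linarith⟩
    have h1 := huc (r, t + r) ⟨⟨hr.1, by linarith [hr.2]⟩, hmem r ⟨hr.1, hr.2.le⟩⟩ (0, t)
      ⟨⟨le_rfl, zero_le_one⟩, h0T⟩ (by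
        rw [Prod.dist_eq, Real.dist_eq, Real.dist_eq]
        simp only [sub_zero, add_sub_cancel_left, max_self, abs_of_nonneg hr.1]
        linarith [hr.2])
    rw [dist_eq_norm, neg_zero, transport_zero] at h1
    have e : transport (-r) (-(Complex.I • p (t + r))) + (1 : ℝ) • (Complex.I • p t)
        = -(Complex.I • (transport (-r) (p (t + r)) - p t)) := by
      rw [one_smul, map_neg, map_smul, smul_sub]; abel
    rw [e, norm_neg, norm_smul, Complex.norm_I, one_mul]
    exact h1.le
  have := norm_image_sub_le_of_norm_deriv_le_segment' hd hb δ (Set.right_mem_Icc.2 hδ.le)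
  rw [sub_zero] at this
  refine le_trans (le_of_eq ?_) this
  congr 1
  rw [neg_zero, transport_zero, add_zero, zero_smul, add_zero, real_smul_eq, smul_smul]
  abel

/-! ### A discrete Gronwall inequality -/

theorem le_exp_mul_of_succ_le {e : ℕ → ℝ} {B δ c : ℝ} (hB : 0 ≤ B) (hδ : 0 ≤ δ) (hc : 0 ≤ c)
    (h0 : 0 ≤ e 0) {N : ℕ} (h : ∀ m < N, e (m + 1) ≤ (1 + B * δ) * e m + δ * c) :
    ∀ m ≤ N, e m ≤ Real.exp (B * (δ * m)) * (e 0 + δ * m * c) := by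
  intro m
  induction m with
  | zero => intro _; simp
  | succ m ih =>
    intro hm
    have ih := ih (by omega)
    have h1 : 1 + B * δ ≤ Real.exp (B * δ) := by
      rw [add_comm]; exact Real.add_one_le_exp _
    have h2 : (1 : ℝ) ≤ Real.exp (B * (δ * (m + 1 : ℕ))) := Real.one_le_exp (by positivity)
    calc e (m + 1) ≤ (1 + B * δ) * e m + δ * c := h m (by omega)
      _ ≤ (1 + B * δ) * (Real.exp (B * (δ * m)) * (e 0 + δ * m * c)) + δ * c := by gcongr
      _ ≤ Real.exp (B * δ) * (Real.exp (B * (δ * m)) * (e 0 + δ * m * c)) + δ * c := by gcongr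
      _ = Real.exp (B * (δ * (m + 1 : ℕ))) * (e 0 + δ * m * c) + 1 * (δ * c) := by
        rw [← mul_assoc, ← Real.exp_add]; push_cast; ring_nf
      _ ≤ Real.exp (B * (δ * (m + 1 : ℕ))) * (e 0 + δ * m * c)
          + Real.exp (B * (δ * (m + 1 : ℕ))) * (δ * c) := by gcongr
      _ = _ := by push_cast; ring

end NLQW
end

/-! ### The cutoff nonlinearity, convergence of the truncated walk, and removal of the cutoff. -/

noncomputable section

namespace NLQW

/-! ### Coefficients -/

theorem setIntegral_Icc_norm_le {E : Type*} [NormedAddCommGroup E] {b : ℝ → E}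
    (hb : MemLp b 2 volume) (x : ℝ) :
    ∫ y in Set.Icc x (x + 1), ‖b y‖ ≤ (eLpNorm b 2 volume).toReal := by
  have hp : IsProbabilityMeasure (volume.restrict (Set.Icc x (x + 1))) :=
    ⟨by rw [Measure.restrict_apply_univ, Real.volume_Icc]; simp⟩
  have hr := hb.restrict (Set.Icc x (x + 1))
  rw [integral_norm_eq_lintegral_enorm hr.1]
  refine ENNReal.toReal_mono hb.2.ne ?_
  rw [← eLpNorm_one_eq_lintegral_enorm]
  exact (eLpNorm_le_eLpNorm_of_exponent_le (by norm_num) hr.1).trans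
    (eLpNorm_mono_measure _ Measure.restrict_le_self)

/-- A `C¹` function which is square integrable with its derivative is bounded. -/
theorem exists_bound_of_memLp_deriv {E : Type*} [NormedAddCommGroup E] [NormedSpace ℝ E]
    [CompleteSpace E] {b : ℝ → E} (hb : ContDiff ℝ 1 b) (h0 : MemLp b 2 volume)
    (h1 : MemLp (deriv b) 2 volume) : ∃ C, ∀ x, ‖b x‖ ≤ C := by
  refine ⟨(eLpNorm b 2 volume).toReal + (eLpNorm (deriv b) 2 volume).toReal, fun x => ?_⟩
  have hc : Continuous (deriv b) := hb.continuous_deriv le_rfl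
  -- On a unit interval `b` oscillates by at most the `L²` norm of its derivative; averaging over
  -- the interval then bounds `‖b x‖`.
  have key : ∀ y ∈ Set.Icc x (x + 1),
      ‖b x‖ - (eLpNorm (deriv b) 2 volume).toReal ≤ ‖b y‖ := by
    intro y hy
    have e : ∫ z in x..y, deriv b z = b y - b x :=
      intervalIntegral.integral_deriv_eq_sub (fun z _ => (hb.differentiable one_ne_zero) z)
        (hc.intervalIntegrable _ _)
    have n1 : ‖b y - b x‖ ≤ ∫ z in Set.Icc x (x + 1), ‖deriv b z‖ := by
      rw [← e]
      refine (intervalIntegral.norm_integral_le_integral_norm hy.1).trans ?_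
      rw [intervalIntegral.integral_of_le hy.1, ← integral_Icc_eq_integral_Ioc]
      refine setIntegral_mono_set (hc.norm.integrableOn_Icc)
        (Eventually.of_forall fun _ => norm_nonneg _) ?_
      exact (Set.Icc_subset_Icc_right hy.2).eventuallyLE
    have n2 := setIntegral_Icc_norm_le h1 x
    have n3 := norm_sub_norm_le (b x) (b y)
    rw [norm_sub_rev] at n3
    linarith
  have hint : ‖b x‖ - (eLpNorm (deriv b) 2 volume).toReal
      ≤ ∫ y in Set.Icc x (x + 1), ‖b y‖ := by
    have := setIntegral_mono_on (μ := volume)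
      (f := fun _ => ‖b x‖ - (eLpNorm (deriv b) 2 volume).toReal)
      continuous_const.integrableOn_Icc hb.continuous.norm.integrableOn_Icc measurableSet_Icc key
    simpa using this
  linarith [setIntegral_Icc_norm_le h0 x]

/-- The one-dimensional Sobolev bound applied to `a'`, which is why `a''` must also be square
integrable and `s ≥ 1` is wanted. -/
theorem exists_lipschitz_of_memLp_deriv {a : ℝ → Coeff} (ha : ContDiff ℝ ∞ a)
    (h0 : MemLp (deriv a) 2 volume) (h1 : MemLp (deriv (deriv a)) 2 volume) :
    ∃ C, ∀ x y, ‖a x - a y‖ ≤ C * |x - y| := by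
  have hd : ContDiff ℝ 1 (deriv a) := by
    exact ((contDiff_infty_iff_deriv.1 ha).2).of_le (by simp)
  obtain ⟨C, hC⟩ := exists_bound_of_memLp_deriv hd h0 h1
  refine ⟨C, fun x y => ?_⟩
  exact Convex.norm_image_sub_le_of_norm_deriv_le (𝕜 := ℝ)
    (fun z _ => (ha.differentiable (by simp)) z) (fun z _ => hC z) convex_univ trivial trivial

theorem contDiff_quadForm (γ : Mat2) : ContDiff ℝ ∞ (quadForm γ) := by
  have h1 : ContDiff ℝ ∞ fun v : Spinor => op γ v := ((op γ).restrictScalars ℝ).contDiff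
  have h2 : ContDiff ℝ ∞ fun v : Spinor => inner ℂ (op γ v) v := h1.inner ℂ contDiff_id
  exact Complex.reCLM.contDiff.comp h2

/-- The nonlinearity can be cut off outside of a ball. -/
theorem exists_truncation (γ : Mat2) {g : ℝ → ℝ} (hg : ContDiff ℝ ∞ g) {R : ℝ} (hR : 0 < R) :
    ∃ G : Spinor → ℝ, Continuous G ∧ (∀ v, ‖v‖ ≤ R → G v = g (quadForm γ v)) ∧
      ∃ K, 0 ≤ K ∧ (∀ v, |G v| ≤ K) ∧ ∀ v w, |G v - G w| * ‖w‖ ≤ K * ‖v - w‖ := by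
  let χ : ContDiffBump (0 : Spinor) := ⟨R, R + 1, hR, by linarith⟩
  let G : Spinor → ℝ := fun v => χ v * g (quadForm γ v)
  have hGs : ContDiff ℝ ∞ G := χ.contDiff.mul (hg.comp (contDiff_quadForm γ))
  have hGc : HasCompactSupport G := χ.hasCompactSupport.mul_right
  obtain ⟨C, hC⟩ := hGs.lipschitzWith_of_hasCompactSupport hGc (by simp)
  obtain ⟨D, hD⟩ := hGc.exists_bound_of_continuous hGs.continuous
  have hD0 : 0 ≤ D := (norm_nonneg _).trans (hD 0)
  have hout : ∀ v, R + 1 ≤ ‖v‖ → G v = 0 := fun v hv => by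
    simp only [G]
    rw [χ.zero_of_le_dist (by simpa using hv), zero_mul]
  have hL : ∀ v w, |G v - G w| ≤ C * ‖v - w‖ := fun v w => by
    have := hC.dist_le_mul v w
    rwa [Real.dist_eq, dist_eq_norm] at this
  refine ⟨G, hGs.continuous, fun v hv => ?_, C * (R + 1) + D, by positivity, fun v => ?_,
    fun v w => ?_⟩
  · simp only [G]
    rw [χ.one_of_mem_closedBall (by simpa using hv), one_mul]
  · refine (hD v).trans (le_add_of_nonneg_left (by positivity))
  · rcases le_or_gt ‖w‖ (R + 1) with hw | hw
    · calc |G v - G w| * ‖w‖ ≤ C * ‖v - w‖ * (R + 1) := by gcongr; exact hL v w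
        _ ≤ _ := by nlinarith [mul_nonneg hD0 (norm_nonneg (v - w))]
    · rcases le_or_gt ‖v‖ (R + 1) with hv | hv
      · have h1 : ‖w‖ ≤ ‖v‖ + ‖v - w‖ := by
          have := norm_sub_norm_le w v
          rw [norm_sub_rev] at this
          linarith
        have h2 : |G v - G w| ≤ D := by
          rw [hout w hw.le, sub_zero]; exact hD v
        calc |G v - G w| * ‖w‖ ≤ |G v - G w| * (‖v‖ + ‖v - w‖) := by gcongr
          _ = |G v - G w| * ‖v‖ + |G v - G w| * ‖v - w‖ := by ring
          _ ≤ C * ‖v - w‖ * (R + 1) + D * ‖v - w‖ := by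
            gcongr
            exact hL v w
          _ = _ := by ring
      · rw [hout v hv.le, hout w hw.le]
        simp
        positivity

/-! ### The truncated walk -/

/-- The walk with the nonlinearity `v ↦ G v`. -/
def truncWalk (a : ℝ → Coeff) (γ : Mat2) (G : Spinor → ℝ) (δ : ℝ) (w : ℤ → Spinor) :
    ℕ → (ℤ → Spinor)
  | 0 => w
  | m + 1 => shift fun n => coinMap a γ G δ (δ * n) (truncWalk a γ G δ w m n)

variable {a : ℝ → Coeff} {γ : Mat2} {G : Spinor → ℝ} {K δ : ℝ} {w : ℤ → Spinor}

theorem summable_coinMap (hγ : γ.IsHermitian) (hw : Summable fun n => ‖w n‖ ^ 2) :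
    Summable fun n : ℤ => ‖coinMap a γ G δ (δ * n) (w n)‖ ^ 2 := by
  simpa only [norm_coinMap hγ] using hw

theorem summable_truncWalk (hγ : γ.IsHermitian) (hw : Summable fun n => ‖w n‖ ^ 2) (m : ℕ) :
    Summable fun n => ‖truncWalk a γ G δ w m n‖ ^ 2 := by
  induction m with
  | zero => exact hw
  | succ m ih => exact summable_norm_sq_shift (summable_coinMap hγ ih)

theorem TameCoefficients.superposition_step (h : TameCoefficients a G K) (hG : Continuous G)
    (hγ : γ.IsHermitian) (hδ : 0 < δ) (hw : Summable fun n => ‖w n‖ ^ 2) :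
    superposition (stepCoin a γ G δ) (step δ w)
      = step δ fun n => coinMap a γ G δ (δ * n) (w n) := by
  ext1
  filter_upwards [(h.linearGrowth_stepCoin hG hγ δ).coeFn (step δ w), coeFn_step hδ hw,
    coeFn_step hδ (summable_coinMap (a := a) (G := G) (δ := δ) hγ hw)] with x h1 h2 h3
  rw [h1, h2, h3, stepCoin]

/-- This writes a walk step as a map defined on all of `L²`, so that it can also be applied to the
solution itself. -/
theorem TameCoefficients.step_truncWalk_succ (h : TameCoefficients a G K) (hG : Continuous G)
    (hγ : γ.IsHermitian) (hδ : 0 < δ) (hw : Summable fun n => ‖w n‖ ^ 2) (m : ℕ) :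
    step δ (truncWalk a γ G δ w (m + 1))
      = transport δ (superposition (stepCoin a γ G δ) (step δ (truncWalk a γ G δ w m))) := by
  have hs := summable_truncWalk (a := a) (G := G) (δ := δ) hγ hw m
  rw [h.superposition_step hG hγ hδ hs, transport_step hδ (summable_coinMap hγ hs)]
  rfl

theorem norm_step_truncWalk_le (hγ : γ.IsHermitian) (hδ : 0 < δ) (h : TameCoefficients a G K)
    (hG : Continuous G) (hw : Summable fun n => ‖w n‖ ^ 2) (m : ℕ) :
    ‖step δ (truncWalk a γ G δ w m)‖ ≤ ‖step δ w‖ := by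
  induction m with
  | zero => exact le_rfl
  | succ m ih =>
    rw [h.step_truncWalk_succ hG hγ hδ hw, norm_transport]
    refine le_trans (le_of_le_of_eq (Lp.norm_le_mul_norm_of_ae_le_mul (c := 1) ?_)
      (one_mul _)) ih
    filter_upwards [(h.linearGrowth_stepCoin hG hγ δ).coeFn
      (step δ (truncWalk a γ G δ w m))] with x hx
    rw [hx, stepCoin, norm_coinMap hγ, one_mul]

/-- The truncated walk agrees with the walk as long as it stays in the ball in which the
nonlinearity is not modified. -/
theorem walk_eq_truncWalk {g : ℝ → ℝ} {R : ℝ} (hGg : ∀ v, ‖v‖ ≤ R → G v = g (quadForm γ v))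
    (m : ℕ) (hb : ∀ k < m, ∀ n, ‖truncWalk a γ G δ w k n‖ ≤ R) :
    walk a γ g δ m w = truncWalk a γ G δ w m := by
  induction m with
  | zero => rfl
  | succ m ih =>
    rw [walk, truncWalk, ih fun k hk => hb k (by omega)]
    congr 1
    funext n
    rw [coin, nonlinearCoin, coinMap, hGg _ (hb m (by omega) n)]

/-- A discrete `H¹` bound, uniform in `δ`, for use in the sup bound. Translation commutes with the
free flow and, up to `O(δ)` times the difference and `O(δ²)`, with the coins, so Gronwall propagates
the initial bound. -/
theorem TameCoefficients.exists_norm_trans_sub_le (h : TameCoefficients a G K)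
    (hG : Continuous G) (hγ : γ.IsHermitian) {T : ℝ} (hT : 0 ≤ T) {u₀ u₀' : L2}
    (hu₀ : IsWeakDeriv 1 u₀ u₀') :
    ∃ M, 0 ≤ M ∧ ∀ᶠ δ : ℝ in 𝓝[>] 0, ∀ m : ℕ, δ * m ≤ T →
      ‖trans δ (step δ (truncWalk a γ G δ (shannonInv δ u₀) m))
        - step δ (truncWalk a γ G δ (shannonInv δ u₀) m)‖ ≤ M * δ := by
  obtain ⟨B, hB, hev⟩ := h.exists_stepCoin_bounds hG hγ
  refine ⟨Real.exp (B * T) * (‖u₀'‖ + T * (B * ‖u₀‖)), by positivity, ?_⟩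
  filter_upwards [hev, self_mem_nhdsWithin] with δ ⟨_, h2⟩ hδ m hm
  have hδ : 0 < δ := hδ
  have hs := summable_norm_sq_shannonInv hδ u₀
  set F : ℕ → L2 := fun m => step δ (truncWalk a γ G δ (shannonInv δ u₀) m) with hF
  have hrec : ∀ k < m, ‖trans δ (F (k + 1)) - F (k + 1)‖
      ≤ (1 + B * δ) * ‖trans δ (F k) - F k‖ + δ * (B * δ * ‖u₀‖) := by
    intro k _
    have e : F (k + 1) = transport δ (superposition (stepCoin a γ G δ) (F k)) :=
      h.step_truncWalk_succ hG hγ hδ hs k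
    rw [e, ← transport_trans, ← map_sub, norm_transport]
    refine (h2 (F k)).trans ?_
    have n1 : ‖F k‖ ≤ ‖u₀‖ :=
      (norm_step_truncWalk_le hγ hδ h hG hs k).trans (norm_sample_le hδ u₀)
    have : B * δ * δ * ‖F k‖ ≤ B * δ * δ * ‖u₀‖ := by gcongr
    linarith
  have h0 : ‖trans δ (F 0) - F 0‖ ≤ ‖u₀'‖ * δ := hu₀.norm_trans_sample_sub_le hδ
  have := le_exp_mul_of_succ_le (e := fun k => ‖trans δ (F k) - F k‖) hB hδ.le
    (by positivity) (norm_nonneg _) hrec m le_rfl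
  refine this.trans ?_
  calc _ ≤ Real.exp (B * T) * (‖u₀'‖ * δ + T * (B * δ * ‖u₀‖)) := by gcongr
    _ = _ := by ring

theorem TameCoefficients.eventually_norm_sub_le (h : TameCoefficients a G K)
    (hG : Continuous G) (hγ : γ.IsHermitian) {T : ℝ} (hT : 0 ≤ T) {u u' : ℝ → L2}
    (hu' : ∀ t ∈ Set.Icc 0 T, IsWeakDeriv 1 (u t) (u' t))
    (hu : ∀ t ∈ Set.Icc 0 T, HasDerivWithinAt u
      (-sigmaThree (u' t) - Complex.I • superposition (potential a γ G) (u t)) (Set.Icc 0 T) t)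
    {ε : ℝ} (hε : 0 < ε) :
    ∀ᶠ δ : ℝ in 𝓝[>] 0, ∀ m : ℕ, δ * m ≤ T →
      ‖step δ (truncWalk a γ G δ (shannonInv δ (u 0)) m) - u (m * δ)‖ ≤ ε := by
  have hcu : ContinuousOn u (Set.Icc 0 T) := fun t ht => (hu t ht).continuousWithinAt
  obtain ⟨P, hP, -, hP2, -⟩ := h.potential_lipschitz γ
  have hcp : ContinuousOn (fun t => superposition (potential a γ G) (u t)) (Set.Icc 0 T) := by
    have : LipschitzWith P.toNNReal (superposition (potential a γ G)) :=
      LipschitzWith.of_dist_le_mul fun f g => by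
        rw [dist_eq_norm, dist_eq_norm, Real.coe_toNNReal _ hP]
        exact (h.linearGrowth_potential hG γ).norm_sub_le hP2 f g
    exact this.continuous.comp_continuousOn hcu
  obtain ⟨U, hU⟩ := (isCompact_Icc.image_of_continuousOn hcu).isBounded.exists_norm_le
  have hU' : ∀ t ∈ Set.Icc 0 T, ‖u t‖ ≤ U := fun t ht => hU _ ⟨t, ht, rfl⟩
  have hU0 : 0 ≤ U := (norm_nonneg _).trans (hU' 0 ⟨le_rfl, hT⟩)
  obtain ⟨B, hB, hev⟩ := h.exists_stepCoin_bounds hG hγ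
  -- With unit error tolerance `ε / D`: the `1` is the initial sampling error, and over total time
  -- `T` the Euler step of the coins adds `U` and the Duhamel step adds `1`; the exponential is the
  -- Gronwall factor.
  set D := Real.exp (B * T) * (1 + T * (U + 1)) with hD
  have hD0 : 0 < D := by positivity
  have hη : 0 < ε / D := by positivity
  filter_upwards [hev, h.eventually_stepCoin_euler hG hγ hη,
    eventually_norm_transport_sub_le hcp hu' hu hη,
    eventually_norm_sample_sub_le (isCompact_singleton (x := u 0)) hη,
    self_mem_nhdsWithin] with δ ⟨h1, _⟩ h2 h3 h4 hδ m hm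
  have hδ : 0 < δ := hδ
  have hs := summable_norm_sq_shannonInv hδ (u 0)
  set F : ℕ → L2 := fun m => step δ (truncWalk a γ G δ (shannonInv δ (u 0)) m) with hF
  have hrec : ∀ k < m, ‖F (k + 1) - u ((k + 1 : ℕ) * δ)‖
      ≤ (1 + B * δ) * ‖F k - u (k * δ)‖ + δ * (ε / D * (U + 1)) := by
    intro k hk
    have e : F (k + 1) = transport δ (superposition (stepCoin a γ G δ) (F k)) :=
      h.step_truncWalk_succ hG hγ hδ hs k
    have hkm : ((k + 1 : ℕ) : ℝ) ≤ m := by exact_mod_cast hk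
    have ht0 : 0 ≤ k * δ := by positivity
    have ht1 : k * δ + δ ≤ T := by
      have : ((k + 1 : ℕ) : ℝ) * δ ≤ m * δ := by gcongr
      push_cast at this
      linarith
    have hk1 : ((k + 1 : ℕ) : ℝ) * δ = k * δ + δ := by push_cast; ring
    have e2 : u ((k + 1 : ℕ) * δ) = transport δ (transport (-δ) (u (k * δ + δ))) := by
      rw [transport_transport, add_neg_cancel, transport_zero, hk1]
    rw [e, e2, ← map_sub, norm_transport]
    have a1 := h1 (F k) (u (k * δ))
    have a2 := h2 (u (k * δ))
    have a3 := h3 (k * δ) ht0 ht1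
    have a4 := hU' (k * δ) ⟨ht0, by linarith⟩
    have a5 : ε / D * δ * ‖u (k * δ)‖ ≤ ε / D * δ * U := by gcongr
    set N := superposition (stepCoin a γ G δ)
    set E := u (k * δ) - (δ * Complex.I : ℂ) • superposition (potential a γ G) (u (k * δ))
    set V := transport (-δ) (u (k * δ + δ))
    -- Stability compares the scheme at `F k` and at the solution; consistency of both the coins and
    -- the equation is needed only along the solution.
    have e3 : N (F k) - V = (N (F k) - N (u (k * δ))) + (N (u (k * δ)) - E) - (V - E) := by abel
    rw [e3]
    have b1 := norm_sub_le ((N (F k) - N (u (k * δ))) + (N (u (k * δ)) - E)) (V - E)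
    have b2 := norm_add_le (N (F k) - N (u (k * δ))) (N (u (k * δ)) - E)
    calc _ ≤ (1 + B * δ) * ‖F k - u (k * δ)‖ + ε / D * δ * U + ε / D * δ := by linarith
      _ = _ := by ring
  have h0 : ‖F 0 - u ((0 : ℕ) * δ)‖ ≤ ε / D := by
    rw [Nat.cast_zero, zero_mul]
    exact h4 (u 0) rfl
  have := le_exp_mul_of_succ_le (e := fun k : ℕ => ‖F k - u (k * δ)‖) hB hδ.le
    (by positivity) (norm_nonneg _) hrec m le_rfl
  refine this.trans ?_
  calc _ ≤ Real.exp (B * T) * (ε / D + T * (ε / D * (U + 1))) := by gcongr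
    _ = ε / D * D := by rw [hD]; ring
    _ = ε := div_mul_cancel₀ _ (ne_of_gt hD0)

/-! ### Solutions of the Dirac equation -/

theorem norm_weakDeriv_le_sobolevNorm {j k : ℕ} (hj : j ≤ k) (f : L2) :
    ‖weakDeriv j f‖ ≤ sobolevNorm k f := by
  refine Real.le_sqrt_of_sq_le ?_
  exact Finset.single_le_sum (f := fun j => ‖weakDeriv j f‖ ^ 2) (fun _ _ => by positivity)
    (Finset.mem_range.2 (by omega))

theorem sobolevNorm_mono {j k : ℕ} (hj : j ≤ k) (f : L2) : sobolevNorm j f ≤ sobolevNorm k f := by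
  refine Real.sqrt_le_sqrt (Finset.sum_le_sum_of_subset_of_nonneg ?_ fun _ _ _ => by positivity)
  exact Finset.range_mono (by omega)

theorem MemH.mono {j k : ℕ} (hj : j ≤ k) {f : L2} (h : MemH k f) : MemH j f :=
  fun i hi => h i (hi.trans hj)

variable {s : ℕ} {g : ℝ → ℝ} {T : ℝ} {u₀ : L2} {u : ℝ → L2}

theorem IsDiracSolution.isWeakDeriv (hs : 1 ≤ s) (hu : IsDiracSolution s a γ g T u₀ u) {t : ℝ}
    (ht : t ∈ Set.Icc 0 T) : IsWeakDeriv 1 (u t) (weakDeriv 1 (u t)) :=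
  (hu.memH t ht).isWeakDeriv hs

/-- For times in `[0, T]` both weak derivatives exist, so their difference is the weak derivative of
the difference, whose norm the `H^s` norm controls; `weakDeriv` need not be additive where it takes
its default value `0`. -/
theorem IsDiracSolution.continuousOn_weakDeriv (hs : 1 ≤ s)
    (hu : IsDiracSolution s a γ g T u₀ u) :
    ContinuousOn (fun t => weakDeriv 1 (u t)) (Set.Icc 0 T) := by
  intro t₀ ht₀
  rw [ContinuousWithinAt, tendsto_iff_norm_sub_tendsto_zero]
  refine squeeze_zero' (Eventually.of_forall fun _ => norm_nonneg _) ?_ (hu.continuous t₀ ht₀)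
  filter_upwards [self_mem_nhdsWithin] with t ht
  rw [← ((hu.isWeakDeriv hs ht).sub (hu.isWeakDeriv hs ht₀)).weakDeriv_eq]
  exact norm_weakDeriv_le_sobolevNorm hs _

theorem IsDiracSolution.continuousOn (hu : IsDiracSolution s a γ g T u₀ u) :
    ContinuousOn u (Set.Icc 0 T) := fun t ht => by
  obtain ⟨w, hw, -⟩ := hu.equation t ht
  exact hw.continuousWithinAt

/-- Solutions are bounded. -/
theorem IsDiracSolution.exists_ae_norm_le (hs : 1 ≤ s) (hu : IsDiracSolution s a γ g T u₀ u) :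
    ∃ R, 0 < R ∧ ∀ t ∈ Set.Icc 0 T, ∀ᵐ x, ‖u t x‖ ≤ R := by
  obtain ⟨A, hA⟩ := (isCompact_Icc.image_of_continuousOn hu.continuousOn).isBounded.exists_norm_le
  obtain ⟨B, hB⟩ :=
    (isCompact_Icc.image_of_continuousOn (hu.continuousOn_weakDeriv hs)).isBounded.exists_norm_le
  refine ⟨|A| + 1 + |B|, by positivity, fun t ht => ?_⟩
  filter_upwards [(hu.isWeakDeriv hs ht).ae_norm_le] with x hx
  have h1 := (hA _ ⟨t, ht, rfl⟩).trans (le_abs_self A)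
  have h2 := (hB _ ⟨t, ht, rfl⟩).trans (le_abs_self B)
  linarith

/-- The values of the solution lie where the cutoff does nothing, so it also solves the equation
with `G`, whose potential term is globally Lipschitz on `L²`. -/
theorem IsDiracSolution.hasDerivWithinAt (hu : IsDiracSolution s a γ g T u₀ u)
    (h : TameCoefficients a G K) (hG : Continuous G) {R : ℝ}
    (hGg : ∀ v, ‖v‖ ≤ R → G v = g (quadForm γ v)) {t : ℝ} (ht : t ∈ Set.Icc 0 T)
    (hR : ∀ᵐ x, ‖u t x‖ ≤ R) :
    HasDerivWithinAt u (-sigmaThree (weakDeriv 1 (u t))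
      - Complex.I • superposition (potential a γ G) (u t)) (Set.Icc 0 T) t := by
  obtain ⟨w, hw, hae⟩ := hu.equation t ht
  convert hw using 1
  ext1
  filter_upwards [hae, hR, coeFn_sigmaThree (weakDeriv 1 (u t)),
    (h.linearGrowth_potential hG γ).coeFn (u t),
    Lp.coeFn_sub (-sigmaThree (weakDeriv 1 (u t)))
      (Complex.I • superposition (potential a γ G) (u t)),
    Lp.coeFn_neg (sigmaThree (weakDeriv 1 (u t))),
    Lp.coeFn_smul Complex.I (superposition (potential a γ G) (u t))] with x h1 h2 h3 h4 h5 h6 h7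
  rw [h5, Pi.sub_apply, h6, Pi.neg_apply, h7, Pi.smul_apply, h3, h4, potential, hGg _ h2]
  have h8 := congr_arg (fun z => -Complex.I • z) h1
  simp only [smul_smul, neg_mul, Complex.I_mul_I, neg_neg, one_smul] at h8
  rw [h8]
  simp only [smul_add, smul_neg, neg_smul, smul_smul, neg_mul, neg_neg,
    Complex.I_mul_I, one_smul]
  abel

theorem IsDiracSolution.eventually_norm_shannon_sub_le (hs : 1 ≤ s) (hT : 0 < T)
    (ha : ContDiff ℝ ∞ a) (ha_bdd : ∃ M : ℝ, ∀ x, ‖a x‖ ≤ M)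
    (ha_deriv : ∀ j ≤ s, MemLp (iteratedDeriv j (deriv a)) 2 volume)
    (hγ : γ.IsHermitian) (hg : ContDiff ℝ ∞ g) (hu : IsDiracSolution s a γ g T u₀ u)
    {ε : ℝ} (hε : 0 < ε) :
    ∀ᶠ δ : ℝ in 𝓝[>] 0, ∀ m : ℕ, δ * m ≤ T →
      ‖shannon δ (walk a γ g δ m (shannonInv δ (bandProj δ u₀))) - u (m * δ)‖ ≤ ε := by
  obtain ⟨R, hR, hb⟩ := hu.exists_ae_norm_le hs
  -- The cutoff starts at `R + 1` rather than `R`, leaving the walk a margin of 1 above the bound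
  -- for the solution.
  obtain ⟨G, hG, hGg, K₁, hK₁, hG1, hG2⟩ := exists_truncation γ hg (R := R + 1) (by linarith)
  obtain ⟨K₂, hK₂⟩ := ha_bdd
  obtain ⟨K₃, hK₃⟩ := exists_lipschitz_of_memLp_deriv ha
    (by simpa using ha_deriv 0 (Nat.zero_le _)) (by simpa using ha_deriv 1 hs)
  have hK₂0 : 0 ≤ K₂ := (norm_nonneg _).trans (hK₂ 0)
  have hK₃0 : 0 ≤ K₃ := by simpa using (norm_nonneg _).trans (hK₃ 1 0)
  have h : TameCoefficients a G (K₁ + K₂ + K₃) :=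
    { nonneg := by positivity
      bound := fun x => (hK₂ x).trans (by linarith)
      lipschitz := fun x y => (hK₃ x y).trans (by gcongr; linarith)
      nl_bound := fun v => (hG1 v).trans (by linarith)
      nl_lipschitz := fun v w => (hG2 v w).trans (by gcongr; linarith) }
  have h0T : (0 : ℝ) ∈ Set.Icc 0 T := ⟨le_rfl, hT.le⟩
  have hu0 : u 0 = u₀ := hu.initial
  have hw0 := hu.isWeakDeriv hs h0T
  rw [hu0] at hw0
  have hd : ∀ t ∈ Set.Icc 0 T, HasDerivWithinAt u (-sigmaThree (weakDeriv 1 (u t))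
      - Complex.I • superposition (potential a γ G) (u t)) (Set.Icc 0 T) t := fun t ht =>
    hu.hasDerivWithinAt h hG hGg ht ((hb t ht).mono fun x hx => by linarith)
  obtain ⟨M, hM, hM'⟩ := h.exists_norm_trans_sub_le hG hγ hT.le hw0
  -- Chosen so that `M √ℓ ≤ 1/2`. With `c = 1/2` the sup bound is `R + 1/2 + 1/2`, exactly the
  -- radius of the cutoff.
  set ℓ : ℝ := (1 / (2 * (M + 1))) ^ 2 with hℓ
  have hℓ0 : 0 < ℓ := by positivity
  have hMℓ : M * √ℓ ≤ 1 / 2 := by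
    rw [hℓ, Real.sqrt_sq (by positivity), mul_one_div, div_le_iff₀ (by positivity)]
    linarith
  -- The second entry forces the strict inequality `< (1/2) √ℓ` required by the sup bound. There is
  -- no circularity, as `M` and `ℓ` depend on the truncated walk only.
  have hε' : 0 < min (ε / 3) (1 / 4 * √ℓ) :=
    lt_min (by positivity) (mul_pos (by norm_num) (Real.sqrt_pos.2 hℓ0))
  have hK := isCompact_Icc.image_of_continuousOn hu.continuousOn
  filter_upwards [hM', h.eventually_norm_sub_le hG hγ hT.le (fun t ht => hu.isWeakDeriv hs ht) hd
      hε', eventually_norm_sample_sub_le hK (by positivity : 0 < ε / 3),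
    eventually_norm_bandProj_sub_le hK (by positivity : 0 < ε / 3), self_mem_nhdsWithin]
    with δ h1 h2 h3 h4 hδ m hm
  have hδ : 0 < δ := hδ
  rw [hu0] at h2
  have hsum := summable_norm_sq_shannonInv hδ u₀
  have hmem : ∀ k : ℕ, δ * k ≤ T → (k * δ : ℝ) ∈ Set.Icc 0 T := fun k hk =>
    ⟨by positivity, by rwa [mul_comm]⟩
  have hsup : ∀ k < m, ∀ n, ‖truncWalk a γ G δ (shannonInv δ u₀) k n‖ ≤ R + 1 := by
    intro k hk n
    have hkT : δ * k ≤ T := by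
      refine le_trans ?_ hm
      gcongr
    have hlt : ‖step δ (truncWalk a γ G δ (shannonInv δ u₀) k) - u (k * δ)‖ < 1 / 2 * √ℓ := by
      refine (h2 k hkT).trans_lt ((min_le_right _ _).trans_lt ?_)
      have := Real.sqrt_pos.2 hℓ0
      linarith
    have := norm_apply_le_of_norm_step_sub_lt hδ (summable_truncWalk hγ hsum k) (by norm_num)
      hℓ0 (h1 k hkT) (hb _ (hmem k hkT)) hlt n
    linarith
  -- Samples see only the frequencies in the band, so the projection of the datum disappears; the
  -- sup bound replaces the walk by the truncated one.
  rw [shannonInv_bandProj, walk_eq_truncWalk hGg m hsup]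
  have hmT := hmem m hm
  have b1 := h2 m hm
  have b2 := h3 (u (m * δ)) ⟨_, hmT, rfl⟩
  have b3 := h4 (u (m * δ)) ⟨_, hmT, rfl⟩
  have b4 := min_le_left (ε / 3) (1 / 4 * √ℓ)
  set W := truncWalk a γ G δ (shannonInv δ u₀) m with hW
  have hWs : Summable fun n => ‖W n‖ ^ 2 := summable_truncWalk hγ hsum m
  -- The interpolated walk is compared with the interpolated samples of `u`, which form `bandProj δ
  -- (u (m * δ))`. The three thirds of `ε` are the walk error, the sampling error and the projection
  -- error.
  have hus := summable_norm_sq_shannonInv hδ (u (m * δ))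
  have c1 := norm_shannon_sub hδ hWs hus
  rw [shannon_shannonInv hδ] at c1
  have c2 : ‖step δ W - step δ (shannonInv δ (u (m * δ)))‖
      ≤ ‖step δ W - u (m * δ)‖ + ‖sample δ (u (m * δ)) - u (m * δ)‖ := by
    rw [norm_sub_rev (sample δ _)]
    exact norm_sub_le_norm_sub_add_norm_sub _ _ _
  have c3 := norm_sub_le_norm_sub_add_norm_sub (shannon δ W) (bandProj δ (u (m * δ))) (u (m * δ))
  linarith

end NLQW
end

/-! ### Existence of the solution and the limit. -/

open NLQW
theorem mainTheorem2 (s : ℕ) (hs : 1 ≤ s) (T L : ℝ) (hT : 0 < T) (hL : 0 < L)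
    (a : ℝ → Coeff) (ha : ContDiff ℝ ∞ a) (ha_bdd : ∃ M : ℝ, ∀ x, ‖a x‖ ≤ M)
    (ha_deriv : ∀ j ≤ s, MemLp (iteratedDeriv j (deriv a)) 2 volume)
    (γ : Mat2) (hγ : γ.IsHermitian) (g : ℝ → ℝ) (hg : ContDiff ℝ ∞ g)
    (hLip : LipCondition s a γ g T L)
    (u₀ : L2) (hu₀ : MemH (s + 1) u₀) (hu₀L : sobolevNorm (s + 1) u₀ ≤ L) :
    (∃ u : ℝ → L2, IsDiracSolution s a γ g T u₀ u) ∧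
    ∀ u : ℝ → L2, IsDiracSolution s a γ g T u₀ u →
      Tendsto
        (fun δ : ℝ => ⨆ (m : ℕ) (_ : δ * m ≤ T),
          ‖shannon δ (walk a γ g δ m (shannonInv δ (bandProj δ u₀))) - u (m * δ)‖ₑ)
        (𝓝[>] 0) (𝓝 0) := by
  constructor
  · obtain ⟨C, -, hC⟩ := hLip
    have hm := hu₀.mono s.le_succ
    have hn := (sobolevNorm_mono s.le_succ u₀).trans hu₀L
    -- The Lipschitz condition is applied to the pair `(u₀, u₀)`, admissible since the `H^s` norm is
    -- at most the `H^{s+1}` norm.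
    obtain ⟨u, -, hu, -⟩ := hC u₀ u₀ hm hm hn hn
    exact ⟨u, hu⟩
  · intro u hu
    rw [ENNReal.tendsto_nhds_zero]
    intro ε hε
    -- The supremum is taken in `[0, ∞]`, so an infinite tolerance must be set aside before passing
    -- to a real `ε`.
    rcases eq_or_ne ε ⊤ with rfl | hε_top
    · simp
    have hε' : 0 < ε.toReal := ENNReal.toReal_pos hε.ne' hε_top
    filter_upwards [hu.eventually_norm_shannon_sub_le hs hT ha ha_bdd ha_deriv hγ hg hε']
      with δ hδ
    refine iSup₂_le fun m hm => ?_
    rw [← ofReal_norm]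
    exact ENNReal.ofReal_le_of_le_toReal (hδ m hm)
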